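/- Let $k$ be an algebraically closed field of characteristic zero. Let $\Sigma=(X,\mathcal R,\mathcal D)$ be a genus zero super Riemann surface over $k$ with $n_R$ Ramond punctures. That is: * $X$ is a proper, connected superscheme over $k$ which is smooth of dimension $(1|1)$ (the sheaf $\Omega^1_X$ of differentials is locally free of rank $(1|1)$), with coherent odd part, and whose bosonic reduction $C=X_{\mathrm{bos}}$ has genus zero, i.e. $H^1(C,\mathcal O_C)=0$; * $\mathcal R\subset X$ is an effective Cartier divisor, unramified over $k$ (its bosonic reduction is a reduced divisor on $C$) and consisting of $n_R$ labeled components, the Ramond punctures; * $\mathcal D\subset\mathcal T_X$ is a subbundle of rank $(0|1)$ such that the supercommutator of vector fields, composed with the projection $\mathcal T_X\to\mathcal T_X/\mathcal D$, induces an isomorphism of $\mathcal O_X$-modules $\mathcal D^{\otimes 2}\to(\mathcal T_X/\mathcal D)(-\mathcal R)\subset \mathcal T_X/\mathcal D$. Let $\mathcal A_\Sigma\subset\mathcal T_X$ be the sheaf of superconformal vector fields, i.e. of the (even and odd, and sums of such) vector fields $\mathfrak X$ with $[\mathcal D,\mathfrak X]\subset\mathcal D$. **Theorem.** If $n_R\ge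 4$, then $\Sigma$ has no nonzero global superconformal vector fields: $H^0(X,\mathcal A_\Sigma)=0$. -/

import Mathlib

open CategoryTheory AlgebraicGeometry TopologicalSpace Opposite

universe u

noncomputable section

namespace SuperGeometry

/-! ### Superschemes -/

/-- A superscheme over `Spec k`, presented by the homogeneous parts of its structure sheaf:
the scheme `even = (X, 𝒪⁺)` over `k`, the quasi-coherent `𝒪⁺`-module `odd = 𝒪⁻`, and the
product `𝒪⁻ × 𝒪⁻ → 𝒪⁺`, which is bilinear, alternating (supercommutativity) and associative. The
remaining products are the ring structure of `𝒪⁺` and the action of `𝒪⁺` on `𝒪⁻`. -/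
structure SuperScheme (k : Type u) [Field k] where
  even : Scheme.{u}
  toSpec : even ⟶ Spec (.of k)
  odd : even.Modules
  isQuasicoherent : odd.IsQuasicoherent
  mul (U : even.Opens) : Γ(odd, U) →ₗ[Γ(even, U)] Γ(odd, U) →ₗ[Γ(even, U)] Γ(even, U)
  mul_self (U : even.Opens) (m : Γ(odd, U)) : mul U m m = 0
  mul_smul_assoc (U : even.Opens) (l m n : Γ(odd, U)) : mul U l m • n = mul U m n • l
  map_mul {U V : even.Opens} (h : V ≤ U) (m n : Γ(odd, U)) :
    even.presheaf.map (homOfLE h).op (mul U m n) =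
      mul V (odd.presheaf.map (homOfLE h).op m) (odd.presheaf.map (homOfLE h).op n)

variable {k : Type u} [Field k]

namespace SuperScheme

variable (X : SuperScheme k)

/-- The sections `𝒪(U) = 𝒪⁺(U) ⊕ 𝒪⁻(U)` of the structure sheaf of a superscheme. -/
def Fun (U : X.even.Opens) : Type u := Γ(X.even, U) × Γ(X.odd, U)

variable {X}

namespace Fun

variable {U : X.even.Opens}

instance : AddCommGroup (Fun X U) := inferInstanceAs (AddCommGroup (Γ(X.even, U) × Γ(X.odd, U)))

/-- The even component of a superfunction. -/
def ev : Fun X U →+ Γ(X.even, U) := AddMonoidHom.fst _ _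

/-- The odd component of a superfunction. -/
def od : Fun X U →+ Γ(X.odd, U) := AddMonoidHom.snd _ _

/-- The inclusion `𝒪⁺ ⊆ 𝒪`. -/
def ofEven : Γ(X.even, U) →+ Fun X U := AddMonoidHom.inl _ _

/-- The inclusion `𝒪⁻ ⊆ 𝒪`. -/
def ofOdd : Γ(X.odd, U) →+ Fun X U := AddMonoidHom.inr _ _

@[ext] lemma ext {a b : Fun X U} (h₀ : a.ev = b.ev) (h₁ : a.od = b.od) : a = b := Prod.ext h₀ h₁

@[simp] lemma ev_ofEven (f : Γ(X.even, U)) : (ofEven f).ev = f := rfl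
@[simp] lemma od_ofEven (f : Γ(X.even, U)) : (ofEven f).od = 0 := rfl
@[simp] lemma ev_ofOdd (m : Γ(X.odd, U)) : (ofOdd m).ev = 0 := rfl
@[simp] lemma od_ofOdd (m : Γ(X.odd, U)) : (ofOdd m).od = m := rfl

instance : One (Fun X U) := ⟨ofEven 1⟩
instance : Mul (Fun X U) :=
  ⟨fun a b ↦ ofEven (a.ev * b.ev + X.mul U a.od b.od) + ofOdd (a.ev • b.od + b.ev • a.od)⟩

@[simp] lemma ev_one : (1 : Fun X U).ev = 1 := rfl
@[simp] lemma od_one : (1 : Fun X U).od = 0 := rfl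
@[simp] lemma ev_mul (a b : Fun X U) : (a * b).ev = a.ev * b.ev + X.mul U a.od b.od := by
  exact add_zero (a.ev * b.ev + X.mul U a.od b.od)
@[simp] lemma od_mul (a b : Fun X U) : (a * b).od = a.ev • b.od + b.ev • a.od := by
  exact zero_add (a.ev • b.od + b.ev • a.od)

instance : Ring (Fun X U) where
  __ := (inferInstance : AddCommGroup (Fun X U))
  one_mul a := by ext <;> simp
  mul_one a := by ext <;> simp
  zero_mul a := by ext <;> simp
  mul_zero a := by ext <;> simp
  left_distrib a b c := by
    ext
    · simp; ring
    · simp [smul_add, add_smul]; abel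
  right_distrib a b c := by
    ext
    · simp; ring
    · simp [smul_add, add_smul]; abel
  mul_assoc a b c := by
    ext
    · simp; ring
    · simp only [ev_mul, od_mul, smul_add, add_smul, mul_smul, X.mul_smul_assoc U a.od b.od c.od]
      rw [smul_comm c.ev a.ev, smul_comm c.ev b.ev]
      abel

/-- The parity involution `a⁺ + a⁻ ↦ a⁺ - a⁻`, i.e. `a ↦ (-1)^|a| a` on homogeneous `a`. -/
def parity : Fun X U →+ Fun X U := ofEven.comp ev - ofOdd.comp od

@[simp] lemma ev_parity (a : Fun X U) : a.parity.ev = a.ev := by simp [parity]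
@[simp] lemma od_parity (a : Fun X U) : a.parity.od = -a.od := by simp [parity]

lemma ofEven_add_ofOdd (a : Fun X U) : ofEven a.ev + ofOdd a.od = a := by ext <;> simp

/-- Restriction of superfunctions to a smaller open set. -/
def res {U V : X.even.Opens} (h : V ≤ U) : Fun X U →+* Fun X V where
  toFun a := ofEven (X.even.presheaf.map (homOfLE h).op a.ev) +
    ofOdd (X.odd.presheaf.map (homOfLE h).op a.od)
  map_one' := by ext <;> simp
  map_zero' := by ext <;> simp
  map_mul' a b := by ext <;> simp [X.map_mul, Scheme.Modules.map_smul]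
  map_add' a b := by ext <;> simp

@[simp] lemma ev_res {U V : X.even.Opens} (h : V ≤ U) (a : Fun X U) :
    (res h a).ev = X.even.presheaf.map (homOfLE h).op a.ev := by simp [res]
@[simp] lemma od_res {U V : X.even.Opens} (h : V ≤ U) (a : Fun X U) :
    (res h a).od = X.odd.presheaf.map (homOfLE h).op a.od := by simp [res]

lemma res_res {U V W : X.even.Opens} (h : V ≤ U) (h' : W ≤ V) (a : Fun X U) :
    res h' (res h a) = res (h'.trans h) a := by
  ext
  · simp only [ev_res, ← ConcreteCategory.comp_apply, ← Functor.map_comp]; rfl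
  · simp only [od_res, ← ConcreteCategory.comp_apply, ← Functor.map_comp]; rfl

variable (X U) in
/-- The constant functions. -/
def const : k →+* Γ(X.even, U) :=
  ((X.even.presheaf.map (homOfLE le_top).op).hom.comp X.toSpec.appTop.hom).comp
    (Scheme.ΓSpecIso (.of k)).inv.hom

end Fun

/-! ### Bosonic reduction, differentials, coordinates -/

variable (X) in
/-- The even part `(𝒪⁻)²` of the ideal generated by the odd functions. -/
def oddSq (U : X.even.Opens) : Ideal Γ(X.even, U) :=
  Ideal.span {f | ∃ m n : Γ(X.odd, U), f = X.mul U m n}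

variable (X) in
/-- The bosonic reduction: since `𝒪/𝒥 = 𝒪⁺/(𝒪⁻)²`, it is the closed subscheme of `(X, 𝒪⁺)` cut
out by `(𝒪⁻)²`. -/
def bos : Scheme.{u} :=
  (Scheme.IdealSheafData.ofIdeals fun U : X.even.affineOpens ↦ X.oddSq U.1).subscheme

variable (X) in
/-- The defining relations of the module of differentials of the superalgebra `𝒪(U)` over `k`:
`d` is additive, kills constants, and satisfies `d(ab) = a db + (-1)^(|a||b|) b da`. -/
def kaehlerRel (U : X.even.Opens) : Set (Fun X U →₀ Fun X U) :=
  {r | ∃ a b, r = .single (a + b) 1 - (.single a 1 + .single b 1)} ∪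
  {r | ∃ c : k, r = .single (.ofEven (Fun.const X U c)) 1} ∪
  {r | ∃ a b, r = .single (a * b) 1 -
    (.single b a + .single a (.ofEven b.ev) + .single a.parity (.ofOdd b.od))}

variable (X) in
/-- The (left) module `Ω¹` of differentials of the superalgebra `𝒪(U)` over `k`. -/
abbrev Kaehler (U : X.even.Opens) : Type u :=
  (Fun X U →₀ Fun X U) ⧸ Submodule.span (Fun X U) (X.kaehlerRel U)

/-- The universal differential `d : 𝒪(U) → Ω¹`. -/
def Fun.d {U : X.even.Opens} (a : Fun X U) : X.Kaehler U :=
  Submodule.Quotient.mk (.single a 1)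

/-- `(t | θ)` are coordinates on `U`: the module `Ω¹` is free with basis `(dt | dθ)`. -/
def IsCoordinates {U : X.even.Opens} (t : Γ(X.even, U)) (θ : Γ(X.odd, U)) : Prop :=
  Function.Bijective fun p : Fun X U × Fun X U ↦
    p.1 • (Fun.ofEven t).d + p.2 • (Fun.ofOdd θ).d

variable (X) in
/-- A supercurve: a proper, connected superscheme, smooth of dimension `(1|1)`, i.e. `Ω¹` is
locally free of rank `(1|1)`, with local bases given by the differentials of coordinates. (For
superschemes whose odd part is coherent, properness is a condition on `(X, 𝒪⁺)`.) -/
structure IsSupercurve : Prop where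
  proper : IsProper X.toSpec
  coherent (U : X.even.Opens) : IsAffineOpen U → Module.Finite Γ(X.even, U) Γ(X.odd, U)
  connected : ConnectedSpace X.even
  smooth (x : X.even) : ∃ U : X.even.Opens, x ∈ U ∧ IsAffineOpen U ∧
    ∃ (t : Γ(X.even, U)) (θ : Γ(X.odd, U)), IsCoordinates t θ

/-- The structure sheaf of a scheme as a sheaf of abelian groups. -/
def _root_.AlgebraicGeometry.Scheme.abSheaf (C : Scheme.{u}) :
    Sheaf (Opens.grothendieckTopology C) AddCommGrpCat.{u} :=
  (sheafCompose _ (forget₂ CommRingCat.{u} RingCat.{u} ⋙ forget₂ RingCat.{u} AddCommGrpCat.{u})).obj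
    C.sheaf

variable (X) in
/-- A supercurve has genus zero if its bosonic reduction `C` has, i.e. `H¹(C, 𝒪_C) = 0`. -/
def IsGenusZero : Prop :=
  letI : HasExt.{u} (Sheaf (Opens.grothendieckTopology X.bos) AddCommGrpCat.{u}) :=
    hasExt_of_enoughInjectives _
  Subsingleton (X.bos.abSheaf.H' 1 (⊤ : Opens X.bos))

/-! ### Vector fields -/

section Parts

variable {U : X.even.Opens}

/-- The parity preserving part of an additive endomorphism of `𝒪(U)`. -/
def evenPart (δ : Fun X U →+ Fun X U) : Fun X U →+ Fun X U :=
  Fun.ofEven.comp (Fun.ev.comp (δ.comp (Fun.ofEven.comp Fun.ev))) +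
    Fun.ofOdd.comp (Fun.od.comp (δ.comp (Fun.ofOdd.comp Fun.od)))

/-- The parity reversing part of an additive endomorphism of `𝒪(U)`. -/
def oddPart (δ : Fun X U →+ Fun X U) : Fun X U →+ Fun X U :=
  Fun.ofOdd.comp (Fun.od.comp (δ.comp (Fun.ofEven.comp Fun.ev))) +
    Fun.ofEven.comp (Fun.ev.comp (δ.comp (Fun.ofOdd.comp Fun.od)))

@[simp] lemma ev_evenPart (δ : Fun X U →+ Fun X U) (a : Fun X U) :
    (evenPart δ a).ev = (δ (.ofEven a.ev)).ev := by simp [evenPart]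
@[simp] lemma od_evenPart (δ : Fun X U →+ Fun X U) (a : Fun X U) :
    (evenPart δ a).od = (δ (.ofOdd a.od)).od := by simp [evenPart]
@[simp] lemma ev_oddPart (δ : Fun X U →+ Fun X U) (a : Fun X U) :
    (oddPart δ a).ev = (δ (.ofOdd a.od)).ev := by simp [oddPart]
@[simp] lemma od_oddPart (δ : Fun X U →+ Fun X U) (a : Fun X U) :
    (oddPart δ a).od = (δ (.ofEven a.ev)).od := by simp [oddPart]

lemma evenPart_add_oddPart (δ : Fun X U →+ Fun X U) (a : Fun X U) :
    evenPart δ a + oddPart δ a = δ a := by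
  conv_rhs => rw [← Fun.ofEven_add_ofOdd a, map_add]
  ext
  · rw [map_add, map_add, ev_evenPart, ev_oddPart]
  · rw [map_add, map_add, od_evenPart, od_oddPart, add_comm]

lemma evenPart_parity (δ : Fun X U →+ Fun X U) (a : Fun X U) :
    evenPart δ a.parity = (evenPart δ a).parity := by ext <;> simp

lemma oddPart_parity (δ : Fun X U →+ Fun X U) (a : Fun X U) :
    oddPart δ a.parity = -(oddPart δ a).parity := by ext <;> simp

lemma parity_parity (a : Fun X U) : a.parity.parity = a := by ext <;> simp

lemma evenPart_add (δ ε : Fun X U →+ Fun X U) : evenPart (δ + ε) = evenPart δ + evenPart ε := by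
  ext a <;> simp

lemma oddPart_add (δ ε : Fun X U →+ Fun X U) : oddPart (δ + ε) = oddPart δ + oddPart ε := by
  ext a <;> simp

lemma evenPart_neg (δ : Fun X U →+ Fun X U) : evenPart (-δ) = -evenPart δ := by
  ext a <;> simp

lemma oddPart_neg (δ : Fun X U →+ Fun X U) : oddPart (-δ) = -oddPart δ := by
  ext a <;> simp

lemma evenPart_zero : evenPart (0 : Fun X U →+ Fun X U) = 0 := by
  ext a <;> simp

lemma oddPart_zero : oddPart (0 : Fun X U →+ Fun X U) = 0 := by
  ext a <;> simp

/-- `f • δ` for a superfunction `f`: the map `a ↦ f * δ a`. -/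
def smulMap (f : Fun X U) (δ : Fun X U →+ Fun X U) : Fun X U →+ Fun X U :=
  (AddMonoidHom.mulLeft f).comp δ

lemma evenPart_smulMap (f : Fun X U) (δ : Fun X U →+ Fun X U) (a : Fun X U) :
    evenPart (smulMap f δ) a = .ofEven f.ev * evenPart δ a + .ofOdd f.od * oddPart δ a := by
  ext <;> simp [smulMap]

lemma oddPart_smulMap (f : Fun X U) (δ : Fun X U →+ Fun X U) (a : Fun X U) :
    oddPart (smulMap f δ) a = .ofEven f.ev * oddPart δ a + .ofOdd f.od * evenPart δ a := by
  ext <;> simp [smulMap]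

lemma ofEven_mul_comm (f : Γ(X.even, U)) (a : Fun X U) :
    Fun.ofEven f * a = a * Fun.ofEven f := by
  ext
  · simp [mul_comm]
  · simp

lemma mul_swap (m n : Γ(X.odd, U)) : X.mul U m n = -X.mul U n m := by
  have h := X.mul_self U (m + n)
  simp only [map_add, LinearMap.add_apply, X.mul_self, zero_add, add_zero] at h
  exact eq_neg_of_add_eq_zero_right h

lemma ofOdd_mul_comm (m : Γ(X.odd, U)) (a : Fun X U) :
    Fun.ofOdd m * a = a.parity * Fun.ofOdd m := by
  ext
  · simp [mul_swap m a.od]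
  · simp

/-- The supercommutator `[δ, ε]`, equal to `δε - (-1)^(|δ||ε|) εδ` on homogeneous maps. -/
def bracketMap (δ ε : Fun X U →+ Fun X U) : Fun X U →+ Fun X U :=
  δ.comp ε - ((evenPart ε).comp (evenPart δ) + (evenPart ε).comp (oddPart δ) +
    (oddPart ε).comp (evenPart δ)) + (oddPart ε).comp (oddPart δ)

lemma evenPart_bracketMap (δ ε : Fun X U →+ Fun X U) (a : Fun X U) :
    evenPart (bracketMap δ ε) a = evenPart δ (evenPart ε a) + oddPart δ (oddPart ε a) -
      evenPart ε (evenPart δ a) + oddPart ε (oddPart δ a) := by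
  have key (b : Fun X U) : bracketMap δ ε b =
      evenPart δ (evenPart ε b + oddPart ε b) + oddPart δ (evenPart ε b + oddPart ε b) -
      (evenPart ε (evenPart δ b) + evenPart ε (oddPart δ b) + oddPart ε (evenPart δ b)) +
      oddPart ε (oddPart δ b) := by
    rw [evenPart_add_oddPart, evenPart_add_oddPart]; rfl
  ext <;> simp [key]

lemma oddPart_bracketMap (δ ε : Fun X U →+ Fun X U) (a : Fun X U) :
    oddPart (bracketMap δ ε) a = evenPart δ (oddPart ε a) + oddPart δ (evenPart ε a) -
      (evenPart ε (oddPart δ a) + oddPart ε (evenPart δ a)) := by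
  have key (b : Fun X U) : bracketMap δ ε b =
      evenPart δ (evenPart ε b + oddPart ε b) + oddPart δ (evenPart ε b + oddPart ε b) -
      (evenPart ε (evenPart δ b) + evenPart ε (oddPart δ b) + oddPart ε (evenPart δ b)) +
      oddPart ε (oddPart δ b) := by
    rw [evenPart_add_oddPart, evenPart_add_oddPart]; rfl
  ext
  · simp [key]
  · simp only [od_oddPart, key, map_add, map_sub, od_evenPart, ev_evenPart, ev_oddPart,
      Fun.ev_ofEven, Fun.od_ofEven, map_zero, zero_add, add_zero]

/-- A `k`-linear superderivation of `𝒪(U)`: a map which kills the constants, whose even part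
satisfies `δ(ab) = δ(a)b + aδ(b)` and whose odd part satisfies `δ(ab) = δ(a)b + (-1)^|a| aδ(b)`. -/
structure IsSuperDerivation (δ : Fun X U →+ Fun X U) : Prop where
  const (c : k) : δ (.ofEven (Fun.const X U c)) = 0
  even_mul (a b : Fun X U) : evenPart δ (a * b) = evenPart δ a * b + a * evenPart δ b
  odd_mul (a b : Fun X U) : oddPart δ (a * b) = oddPart δ a * b + a.parity * oddPart δ b

namespace IsSuperDerivation

variable {δ ε : Fun X U →+ Fun X U}

lemma zero : IsSuperDerivation (0 : Fun X U →+ Fun X U) where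
  const _ := rfl
  even_mul a b := by simp [evenPart_zero]
  odd_mul a b := by simp [oddPart_zero]

lemma add (hδ : IsSuperDerivation δ) (hε : IsSuperDerivation ε) : IsSuperDerivation (δ + ε) where
  const c := by simp [hδ.const, hε.const]
  even_mul a b := by
    simp only [evenPart_add, AddMonoidHom.add_apply, hδ.even_mul, hε.even_mul]; noncomm_ring
  odd_mul a b := by
    simp only [oddPart_add, AddMonoidHom.add_apply, hδ.odd_mul, hε.odd_mul]; noncomm_ring

lemma neg (hδ : IsSuperDerivation δ) : IsSuperDerivation (-δ) where
  const c := by simp [hδ.const]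
  even_mul a b := by
    simp only [evenPart_neg, AddMonoidHom.neg_apply, hδ.even_mul]; noncomm_ring
  odd_mul a b := by
    simp only [oddPart_neg, AddMonoidHom.neg_apply, hδ.odd_mul]; noncomm_ring

lemma smul (f : Fun X U) (hδ : IsSuperDerivation δ) : IsSuperDerivation (smulMap f δ) where
  const c := by simp [smulMap, hδ.const]
  even_mul a b := by
    have h₀ := ofEven_mul_comm f.ev a
    have h₁ := ofOdd_mul_comm f.od a.parity
    rw [parity_parity] at h₁
    simp only [evenPart_smulMap, hδ.even_mul, hδ.odd_mul, mul_add, add_mul, ← mul_assoc, h₀, h₁]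
    abel
  odd_mul a b := by
    have h₀ := ofEven_mul_comm f.ev a.parity
    have h₁ := ofOdd_mul_comm f.od a
    simp only [oddPart_smulMap, hδ.even_mul, hδ.odd_mul, mul_add, add_mul, ← mul_assoc, h₀, h₁]
    abel

lemma bracket (hδ : IsSuperDerivation δ) (hε : IsSuperDerivation ε) :
    IsSuperDerivation (bracketMap δ ε) where
  const c := by
    have e₁ : evenPart δ (.ofEven (Fun.const X U c)) = 0 := by ext <;> simp [hδ.const]
    have e₂ : evenPart ε (.ofEven (Fun.const X U c)) = 0 := by ext <;> simp [hε.const]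
    have o₁ : oddPart δ (.ofEven (Fun.const X U c)) = 0 := by ext <;> simp [hδ.const]
    have o₂ : oddPart ε (.ofEven (Fun.const X U c)) = 0 := by ext <;> simp [hε.const]
    rw [← evenPart_add_oddPart (bracketMap δ ε), evenPart_bracketMap, oddPart_bracketMap,
      e₁, e₂, o₁, o₂]
    simp
  even_mul a b := by
    simp only [evenPart_bracketMap, hδ.even_mul, hδ.odd_mul, hε.even_mul, hε.odd_mul, map_add,
      oddPart_parity, parity_parity]
    noncomm_ring
  odd_mul a b := by
    simp only [oddPart_bracketMap, hδ.even_mul, hδ.odd_mul, hε.even_mul, hε.odd_mul, map_add,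
      evenPart_parity]
    noncomm_ring

end IsSuperDerivation

end Parts

variable (X) in
/-- The sections over `U` of the tangent sheaf `𝒯_X = Der_k(𝒪, 𝒪)`, of both parities: a
superderivation of `𝒪(V)` for each open `V ⊆ U`, compatibly with restrictions. -/
@[ext]
structure VectorField (U : X.even.Opens) where
  app (V : X.even.Opens) (h : V ≤ U) : Fun X V →+ Fun X V
  isSuperDerivation (V : X.even.Opens) (h : V ≤ U) : IsSuperDerivation (app V h)
  res_app {V W : X.even.Opens} (hV : V ≤ U) (hW : W ≤ V) (a : Fun X V) :
    Fun.res hW (app V hV a) = app W (hW.trans hV) (Fun.res hW a)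

namespace VectorField

variable {U : X.even.Opens}

instance : Zero (VectorField X U) := ⟨⟨fun _ _ ↦ 0, fun _ _ ↦ .zero, fun _ _ _ ↦ map_zero _⟩⟩

instance : Add (VectorField X U) := ⟨fun Y Z ↦
  ⟨fun V h ↦ Y.app V h + Z.app V h,
    fun V h ↦ (Y.isSuperDerivation V h).add (Z.isSuperDerivation V h),
    fun hV hW a ↦ by simp [Y.res_app, Z.res_app]⟩⟩

instance : Neg (VectorField X U) := ⟨fun Y ↦
  ⟨fun V h ↦ -Y.app V h, fun V h ↦ (Y.isSuperDerivation V h).neg,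
    fun hV hW a ↦ by simp [Y.res_app]⟩⟩

instance : SMul (Fun X U) (VectorField X U) := ⟨fun f Y ↦
  ⟨fun V h ↦ smulMap (Fun.res h f) (Y.app V h), fun V h ↦ (Y.isSuperDerivation V h).smul _,
    fun hV hW a ↦ by simp [smulMap, Y.res_app, Fun.res_res]⟩⟩

lemma ext_app {Y Z : VectorField X U}
    (h : ∀ (V : X.even.Opens) (hV : V ≤ U) (a : Fun X V), Y.app V hV a = Z.app V hV a) : Y = Z :=
  VectorField.ext (funext fun V ↦ funext fun hV ↦ AddMonoidHom.ext fun a ↦ h V hV a)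

@[simp] lemma zero_app {V : X.even.Opens} (hV : V ≤ U) (a : Fun X V) :
    (0 : VectorField X U).app V hV a = 0 := rfl
@[simp] lemma add_app (Y Z : VectorField X U) {V : X.even.Opens} (hV : V ≤ U) (a : Fun X V) :
    (Y + Z).app V hV a = Y.app V hV a + Z.app V hV a := rfl
@[simp] lemma neg_app (Y : VectorField X U) {V : X.even.Opens} (hV : V ≤ U) (a : Fun X V) :
    (-Y).app V hV a = -Y.app V hV a := rfl
@[simp] lemma smul_app (f : Fun X U) (Y : VectorField X U) {V : X.even.Opens} (hV : V ≤ U)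
    (a : Fun X V) : (f • Y).app V hV a = Fun.res hV f * Y.app V hV a := rfl

instance : AddCommGroup (VectorField X U) where
  add_assoc _ _ _ := ext_app fun _ _ _ ↦ add_assoc _ _ _
  zero_add _ := ext_app fun _ _ _ ↦ zero_add _
  add_zero _ := ext_app fun _ _ _ ↦ add_zero _
  add_comm _ _ := ext_app fun _ _ _ ↦ add_comm _ _
  neg_add_cancel _ := ext_app fun _ _ _ ↦ neg_add_cancel _
  nsmul := nsmulRec
  zsmul := zsmulRec

instance : Module (Fun X U) (VectorField X U) where
  one_smul _ := ext_app fun _ _ _ ↦ by simp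
  mul_smul _ _ _ := ext_app fun _ _ _ ↦ by simp [mul_assoc]
  smul_zero _ := ext_app fun _ _ _ ↦ by simp
  smul_add _ _ _ := ext_app fun _ _ _ ↦ by simp [mul_add]
  add_smul _ _ _ := ext_app fun _ _ _ ↦ by simp [add_mul]
  zero_smul _ := ext_app fun _ _ _ ↦ by simp

/-- Restriction of vector fields. -/
def res {V : X.even.Opens} (h : V ≤ U) (Y : VectorField X U) : VectorField X V :=
  ⟨fun W hW ↦ Y.app W (hW.trans h), fun W hW ↦ Y.isSuperDerivation W (hW.trans h),
    fun hV hW a ↦ Y.res_app (hV.trans h) hW a⟩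

/-- A vector field is even if it preserves parity. -/
def IsEven (Y : VectorField X U) : Prop :=
  ∀ (V : X.even.Opens) (h : V ≤ U), oddPart (Y.app V h) = 0

/-- A vector field is odd if it reverses parity. -/
def IsOdd (Y : VectorField X U) : Prop :=
  ∀ (V : X.even.Opens) (h : V ≤ U), evenPart (Y.app V h) = 0

lemma res_evenPart (Y : VectorField X U) {V W : X.even.Opens} (hV : V ≤ U) (hW : W ≤ V)
    (a : Fun X V) :
    Fun.res hW (evenPart (Y.app V hV) a) = evenPart (Y.app W (hW.trans hV)) (Fun.res hW a) := by
  have h₀ : Fun.ofEven (Fun.res hW a).ev = Fun.res hW (Fun.ofEven a.ev) := by ext <;> simp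
  have h₁ : Fun.ofOdd (Fun.res hW a).od = Fun.res hW (Fun.ofOdd a.od) := by ext <;> simp
  ext
  · rw [ev_evenPart, h₀, ← Y.res_app hV hW]; simp
  · rw [od_evenPart, h₁, ← Y.res_app hV hW]; simp

lemma res_oddPart (Y : VectorField X U) {V W : X.even.Opens} (hV : V ≤ U) (hW : W ≤ V)
    (a : Fun X V) :
    Fun.res hW (oddPart (Y.app V hV) a) = oddPart (Y.app W (hW.trans hV)) (Fun.res hW a) := by
  have h₀ : Fun.ofEven (Fun.res hW a).ev = Fun.res hW (Fun.ofEven a.ev) := by ext <;> simp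
  have h₁ : Fun.ofOdd (Fun.res hW a).od = Fun.res hW (Fun.ofOdd a.od) := by ext <;> simp
  ext
  · rw [ev_oddPart, h₁, ← Y.res_app hV hW]; simp
  · rw [od_oddPart, h₀, ← Y.res_app hV hW]; simp

/-- The supercommutator of vector fields. -/
def bracket (Y Z : VectorField X U) : VectorField X U where
  app V h := bracketMap (Y.app V h) (Z.app V h)
  isSuperDerivation V h := (Y.isSuperDerivation V h).bracket (Z.isSuperDerivation V h)
  res_app hV hW a := by
    simp only [bracketMap, AddMonoidHom.add_apply, AddMonoidHom.sub_apply, AddMonoidHom.comp_apply,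
      map_add, map_sub, res_evenPart, res_oddPart, Y.res_app, Z.res_app]

end VectorField

end SuperScheme

open SuperScheme

/-! ### Super Riemann surfaces with Ramond punctures -/

/-- A super Riemann surface over `k` with `n` (labeled) Ramond punctures: a supercurve `X`, the
ideal sheaf `ideal` of the Ramond divisor `ℛ`, and the distribution `D ⊆ 𝒯_X`. -/
structure SuperRiemannSurface (k : Type u) [Field k] (n : ℕ) where
  X : SuperScheme k
  isSupercurve : X.IsSupercurve
  /-- The ideal sheaf of the Ramond divisor. -/
  ideal (U : X.even.Opens) : Ideal (Fun X U)
  /-- It is a subsheaf of `𝒪`. -/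
  mem_ideal_iff (U : X.even.Opens) (a : Fun X U) : a ∈ ideal U ↔
    ∀ x ∈ U, ∃ (V : X.even.Opens) (hV : V ≤ U), x ∈ V ∧
      ∀ (W : X.even.Opens) (hW : W ≤ V), Fun.res (hW.trans hV) a ∈ ideal W
  /-- It defines an effective Cartier divisor: it is locally generated by an even nonzerodivisor. -/
  ideal_cartier (x : X.even) : ∃ V : X.even.Opens, x ∈ V ∧ ∃ p : Γ(X.even, V),
    ∀ (W : X.even.Opens) (hW : W ≤ V),
      ideal W = Ideal.span {Fun.res hW (.ofEven p)} ∧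
      ∀ a : Fun X W, Fun.res hW (.ofEven p) * a = 0 → a = 0
  /-- The points of `X` underlying the components of the Ramond divisor. -/
  puncture : Fin n → X.even
  puncture_injective : Function.Injective puncture
  /-- The punctures are exactly the points of the divisor. -/
  mem_range_puncture_iff (x : X.even) : x ∈ Set.range puncture ↔
    ∀ (V : X.even.Opens), x ∈ V → ∀ a ∈ ideal V, x ∉ X.even.basicOpen a.ev
  /-- The divisor is unramified over `k`: its bosonic reduction is reduced, that is, in the local
  ring of `X_bos` at a puncture, its ideal is the maximal ideal. -/
  unramified (i : Fin n) (V : X.even.Opens) (hi : puncture i ∈ V) (f : Γ(X.even, V)) :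
    puncture i ∉ X.even.basicOpen f →
    ∃ (W : X.even.Opens) (hW : W ≤ V), puncture i ∈ W ∧ ∃ a ∈ ideal W, ∃ e ∈ X.oddSq W,
      X.even.presheaf.map (homOfLE hW).op f = a.ev + e
  /-- The distribution. -/
  D (U : X.even.Opens) : Submodule (Fun X U) (VectorField X U)
  /-- It is a subsheaf of `𝒯_X`. -/
  mem_D_iff (U : X.even.Opens) (Y : VectorField X U) : Y ∈ D U ↔
    ∀ x ∈ U, ∃ (V : X.even.Opens) (hV : V ≤ U), x ∈ V ∧
      ∀ (W : X.even.Opens) (hW : W ≤ V), Y.res (hW.trans hV) ∈ D W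
  /-- Locally `𝒯_X` has a basis `(E | D₀)` with `E` even and `D₀` odd such that `D₀` generates `D`
  (so `D` is a subbundle of rank `(0|1)`), and `[D₀, D₀] ≡ p E` modulo `D`, where `p` is a
  generator of the ideal of `ℛ`: the supercommutator induces an isomorphism of `D ⊗ D` with
  `(𝒯_X / D)(-ℛ) ⊆ 𝒯_X / D`. -/
  exists_frame (x : X.even) : ∃ V : X.even.Opens, x ∈ V ∧
    ∃ (E D₀ : VectorField X V) (p : Γ(X.even, V)), E.IsEven ∧ D₀.IsOdd ∧
      (∀ (W : X.even.Opens) (hW : W ≤ V),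
        Function.Bijective (fun q : Fun X W × Fun X W ↦ q.1 • E.res hW + q.2 • D₀.res hW) ∧
        D W = Submodule.span (Fun X W) {D₀.res hW} ∧
        ideal W = Ideal.span {Fun.res hW (.ofEven p)}) ∧
      D₀.bracket D₀ - Fun.ofEven p • E ∈ D V

namespace SuperRiemannSurface

variable {n : ℕ} (S : SuperRiemannSurface k n)

/-- The genus of a super Riemann surface is that of its underlying supercurve. -/
def IsGenusZero : Prop := S.X.IsGenusZero

/-- A vector field `Y` on `U` is superconformal, i.e. a section over `U` of the sheaf `𝒜_Σ`,
if `[D, Y] ⊆ D`. -/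
def IsSuperconformal {U : S.X.even.Opens} (Y : VectorField S.X U) : Prop :=
  ∀ (V : S.X.even.Opens) (hV : V ≤ U), ∀ Z ∈ S.D V, Z.bracket (Y.res hV) ∈ S.D V

end SuperRiemannSurface

end SuperGeometry

end

/-!
A superconformal vector field `Y` is controlled by two derivations of the structure sheaf of the
curve `C = (X, 𝒪⁺)`: the restriction of its even part `Y⁺` to `𝒪⁺`, and the restriction of
`(Y⁻)²`, the square of its odd part. Both turn out to vanish at the punctures. A curve of genus zero
has no nonzero vector field with three zeros, so both are zero, and a local computation shows
that then `Y = 0`.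

*The underlying curve.* In coordinates `(t | θ)` every odd function is a unique even multiple of `θ`
(`IsCoordinates.exists_eq_smul`, an application of Nakayama's lemma, and
`IsCoordinates.smul_bijective`). Hence products of odd functions vanish
(`IsSupercurve.mul_eq_zero`), the bosonic reduction is `(X, 𝒪⁺)` itself, and `t` is a coordinate
on `C` (`IsCoordinates.exists_isCoord`). A connected curve with coordinates is integral
(`isIntegral_of_isCoord`): the powers of a coordinate are nonzero because they can be differentiated
in characteristic zero, so the local rings are discrete valuation rings.

*Vector fields in genus zero.* By Mayer-Vietoris, `H¹(C, 𝒪) = 0` yields for each closed point `P` a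
function `f` whose only pole is a simple one at `P` (`IsUniformizer.exists_pole`). If the vector
field `v` vanishes at `P`, `Q` and `R`, then `v(f)` has at most a simple pole at `P` and vanishes at `Q`
and `R`. Such a function is zero (`CurveField.PoleLE.eq_zero_of_vanishes`), and this forces
`v = 0` (`SheafDerivation.app_eq_zero_of_vanishesAt`). This replaces the degree of the tangent
bundle.

*The local computation.* Let `f ∂/∂θ + g θ ∂/∂t` generate `𝒟`. The condition on `[𝒟, 𝒟]` says that
`f` is a unit and `g` generates the ideal of the Ramond divisor, so `g` vanishes simply at
the punctures (`exists_isSplitFrame`). For `Y⁺ = α ∂/∂t + β θ ∂/∂θ` and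
`Y⁻ = γ θ ∂/∂t + η ∂/∂θ`, superconformality gives, writing `'` for `d/dt`,
`f (g α' - α g' - β g) = g (f β - α f')` and `f γ + g η = 0`. The first equation shows that `α`
vanishes at the punctures, and the second that `γ`, and with it the coefficient `γ η` of
`(Y⁻)²`, does (`IsSuperconformal.vanishesAt`). Conversely `α = 0` and `γ η = 0` imply
`β = γ = η = 0` (`IsSuperconformal.eq_zero`).
-/

universe w v

noncomputable section

namespace SuperGeometry

/-! ### Mayer-Vietoris and quasi-coherent modules in terms of sections -/

open Abelian Limits in
/-- If the first cohomology of the total object of a Mayer-Vietoris square vanishes, then every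
section over the intersection is a difference of sections over the two pieces. -/
theorem _root_.CategoryTheory.GrothendieckTopology.MayerVietorisSquare.exists_sub_eq
    {C : Type u} [Category.{v} C] {J : GrothendieckTopology C}
    [HasWeakSheafify J (Type v)] [HasSheafify J AddCommGrpCat.{v}]
    [HasExt.{w} (Sheaf J AddCommGrpCat.{v})] (S : J.MayerVietorisSquare)
    (F : Sheaf J AddCommGrpCat.{v}) (hF : Subsingleton (F.H' 1 S.X₄))
    (a : F.obj.obj (op S.X₁)) :
    ∃ (b : F.obj.obj (op S.X₂)) (c : F.obj.obj (op S.X₃)),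
      F.obj.map S.f₁₂.op b - F.obj.map S.f₁₃.op c = a := by
  -- a section over `X` is the same as a map from the free sheaf on `X`
  let ev (X : C) (φ : (presheafToSheaf J _).obj (yoneda.obj X ⋙ AddCommGrpCat.free) ⟶ F) :
      F.obj.obj (op X) :=
    ((toSheafify J (yoneda.obj X ⋙ AddCommGrpCat.free) ≫ φ.hom).app (op X))
      (FreeAbelianGroup.of (𝟙 X) : FreeAbelianGroup (X ⟶ X))
  have ev_add (X : C) (φ ψ) : ev X (φ + ψ) = ev X φ + ev X ψ := rfl
  have ev_neg (X : C) (φ) : ev X (-φ) = - ev X φ := rfl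
  have ev_nat {X Y : C} (f : X ⟶ Y) (φ) :
      ev X ((presheafToSheaf J _).map (Functor.whiskerRight (yoneda.map f) _) ≫ φ) =
        F.obj.map f.op (ev Y φ) := by
    have h₁ := toSheafify_naturality J (Functor.whiskerRight (yoneda.map f) AddCommGrpCat.free)
    have h₂ := (toSheafify J (yoneda.obj Y ⋙ AddCommGrpCat.free) ≫ φ.hom).naturality f.op
    have h₃ := congr($h₂ (FreeAbelianGroup.of (𝟙 Y) : FreeAbelianGroup (Y ⟶ Y)))
    have h₄ := congr(($h₁ ≫ φ.hom).app (op X)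
      (FreeAbelianGroup.of (𝟙 X) : FreeAbelianGroup (X ⟶ X)))
    refine Eq.trans ?_ h₃
    refine h₄.symm.trans ?_
    have h₅ : ((Functor.whiskerRight (yoneda.map f) AddCommGrpCat.free).app (op X))
        (FreeAbelianGroup.of (𝟙 X) : FreeAbelianGroup (X ⟶ X)) =
        (yoneda.obj Y ⋙ AddCommGrpCat.free).map f.op
          (FreeAbelianGroup.of (𝟙 Y) : FreeAbelianGroup (Y ⟶ Y)) := by
      refine (FreeAbelianGroup.map_of_apply (f := fun g : X ⟶ X ↦ g ≫ f) (𝟙 X)).trans ?_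
      refine Eq.trans ?_ (FreeAbelianGroup.map_of_apply (f := fun g : Y ⟶ Y ↦ f ≫ g) (𝟙 Y)).symm
      simp
    exact congr((toSheafify J (yoneda.obj Y ⋙ AddCommGrpCat.free) ≫ φ.hom).app (op X) $h₅)
  have ev_surj (X : C) (s : F.obj.obj (op X)) : ∃ φ, ev X φ = s := by
    let g : yoneda.obj X ⋙ AddCommGrpCat.free ⟶ F.obj :=
      { app := fun Y ↦ AddCommGrpCat.ofHom
          (FreeAbelianGroup.lift fun f : Y.unop ⟶ X ↦ F.obj.map f.op s)
        naturality := by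
          intro Y Y' f
          refine AddCommGrpCat.hom_ext (FreeAbelianGroup.lift_ext _ _ fun x ↦ ?_)
          have h₁ : (FreeAbelianGroup.lift fun f : Y'.unop ⟶ X ↦ F.obj.map f.op s)
              (FreeAbelianGroup.map (fun x : Y.unop ⟶ X ↦ f.unop ≫ x) (FreeAbelianGroup.of x)) =
              F.obj.map f (FreeAbelianGroup.lift (fun f : Y.unop ⟶ X ↦ F.obj.map f.op s)
                (FreeAbelianGroup.of x)) := by
            simp
          exact h₁ }
    refine ⟨⟨sheafifyLift J g F.property⟩, ?_⟩
    simp only [ev, toSheafify_sheafifyLift]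
    exact (FreeAbelianGroup.lift_apply_of _ _).trans (by simp)
  obtain ⟨ψ, hψ⟩ := ev_surj _ a
  have hex : S.shortComplex_shortExact.extClass.comp (Ext.mk₀ ψ) rfl = 0 :=
    hF.elim _ _
  obtain ⟨x, hx⟩ := Ext.contravariant_sequence_exact₁ S.shortComplex_shortExact _
    (Ext.mk₀ ψ) rfl hex
  obtain ⟨φ, rfl⟩ := (Ext.mk₀_bijective _ _).2 x
  have hφ : S.shortComplex.f ≫ φ = ψ := by
    rw [Ext.mk₀_comp_mk₀] at hx
    exact (Ext.mk₀_bijective _ _).1 hx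
  dsimp only [GrothendieckTopology.MayerVietorisSquare.shortComplex] at φ hφ
  refine ⟨ev S.X₂ (biprod.inl ≫ φ), ev S.X₃ (biprod.inr ≫ φ), ?_⟩
  rw [← hψ, ← hφ, ← ev_nat, ← ev_nat, sub_eq_add_neg, ← ev_neg, ← ev_add]
  congr 1
  have : φ = biprod.desc (biprod.inl ≫ φ) (biprod.inr ≫ φ) := by
    apply biprod.hom_ext' <;> simp
  conv_rhs => rw [this]
  rw [biprod.lift_desc]
  exact congrArg (_ + ·) (Preadditive.neg_comp _ _).symm

theorem exists_sub_eq_of_subsingleton_H1 {T : Type u} [TopologicalSpace T]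
    (F : Sheaf (Opens.grothendieckTopology T) AddCommGrpCat.{u})
    [HasExt.{u} (Sheaf (Opens.grothendieckTopology T) AddCommGrpCat.{u})]
    (hF : Subsingleton (F.H' 1 (⊤ : Opens T))) {U V : Opens T} (hUV : U ⊔ V = ⊤)
    (a : F.obj.obj (op (U ⊓ V))) :
    ∃ (b : F.obj.obj (op U)) (c : F.obj.obj (op V)),
      F.obj.map (homOfLE inf_le_left).op b - F.obj.map (homOfLE inf_le_right).op c = a :=
  (Opens.mayerVietorisSquare'
    { X₁ := U ⊓ V
      X₂ := U
      X₃ := V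
      X₄ := ⊤
      f₁₂ := homOfLE inf_le_left
      f₁₃ := homOfLE inf_le_right
      f₂₄ := homOfLE le_top
      f₃₄ := homOfLE le_top
      fac := Subsingleton.elim _ _ } hUV.symm rfl).exists_sub_eq F hF a

/-- Over an affine open set, the sections of a quasi-coherent module over a basic open set are
the localization of its sections, here in terms of elements. -/
lemma exists_pow_smul_eq {X : Scheme.{u}} (M : X.Modules) [M.IsQuasicoherent] {U : X.Opens}
    (hU : IsAffineOpen U) (s : Γ(X, U)) :
    (∀ m : Γ(M, X.basicOpen s), ∃ (n : ℕ) (m' : Γ(M, U)),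
      M.presheaf.map (homOfLE (X.basicOpen_le s)).op m' =
        X.presheaf.map (homOfLE (X.basicOpen_le s)).op s ^ n • m) ∧
    ∀ m : Γ(M, U), M.presheaf.map (homOfLE (X.basicOpen_le s)).op m = 0 →
      ∃ n : ℕ, s ^ n • m = 0 := by
  let N := M.restrict hU.fromSpec
  have hN : IsLocalizing (modulesSpecToSheaf.obj N) := by
    rw [← isIso_fromTildeΓ_iff_isLocalizing]; infer_instance
  have h := hN s
  let D : (Spec Γ(X, U)).Opens := PrimeSpectrum.basicOpen s
  have hD : hU.fromSpec ''ᵁ D = X.basicOpen s := hU.fromSpec_image_basicOpen s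
  have hT : hU.fromSpec ''ᵁ ⊤ = U := by simp
  let e₁ : Γ(N, ⊤) ≅ Γ(M, U) := M.restrictAppIso _ _ ≪≫ M.presheaf.mapIso (eqToIso hT.symm).op
  let e₂ : Γ(N, D) ≅ Γ(M, X.basicOpen s) :=
    M.restrictAppIso _ _ ≪≫ M.presheaf.mapIso (eqToIso hD.symm).op
  let ρ : Γ(N, ⊤) ⟶ Γ(N, D) := N.presheaf.map (homOfLE le_top).op
  have hcomm : e₁.hom ≫ M.presheaf.map (homOfLE (X.basicOpen_le s)).op = ρ ≫ e₂.hom := by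
    simp only [e₁, e₂, ρ, Iso.trans_hom, Category.assoc, Functor.mapIso_hom]
    rw [← Functor.map_comp, Scheme.Modules.map_restrictAppIso_hom_assoc, ← Functor.map_comp]
    rfl
  have key (W : (Spec Γ(X, U)).Opens) (V : X.Opens) (hV : hU.fromSpec ''ᵁ W = V) (hVU : V ≤ U)
      (r : Γ(X, U)) (m : Γ(N, W)) :
      (M.restrictAppIso _ _ ≪≫ M.presheaf.mapIso (eqToIso hV.symm).op).hom (r • m) =
        X.presheaf.map (homOfLE hVU).op r •
          (M.restrictAppIso _ _ ≪≫ M.presheaf.mapIso (eqToIso hV.symm).op).hom m := by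
    subst hV
    rw [Scheme.Modules.smul_Spec_def]
    have hρ : (Scheme.ΓSpecIso Γ(X, U)).inv ≫ (Spec Γ(X, U)).presheaf.map (Opens.leTop W).op ≫
        (hU.fromSpec.appIso W).inv = X.presheaf.map (homOfLE hVU).op := by
      rw [← Category.assoc, Iso.comp_inv_eq, Scheme.Hom.appIso_hom', Scheme.Hom.map_appLE,
        Scheme.Hom.appLE, hU.fromSpec_app_self, Category.assoc, ← Functor.map_comp]
      rfl
    have h₁ : (hU.fromSpec.appIso W).inv ((Spec Γ(X, U)).presheaf.map (Opens.leTop W).op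
        ((Scheme.ΓSpecIso Γ(X, U)).inv r)) = X.presheaf.map (homOfLE hVU).op r := congr($hρ r)
    have h₂ := Scheme.Modules.smul_restrictAppIso_hom_apply hU.fromSpec M W
      ((Spec Γ(X, U)).presheaf.map (Opens.leTop W).op ((Scheme.ΓSpecIso Γ(X, U)).inv r)) m
    rw [h₁] at h₂
    simp
    exact h₂
  have hs₁ (r : Γ(X, U)) (m : Γ(N, ⊤)) : e₁.hom (r • m) = r • e₁.hom m := by
    have : X.presheaf.map (homOfLE le_rfl).op r = r := by simp
    have h₁ := key ⊤ U hT le_rfl r m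
    rwa [this] at h₁
  have hs₂ (r : Γ(X, U)) (m : Γ(N, D)) : e₂.hom (r • m) =
      X.presheaf.map (homOfLE (X.basicOpen_le s)).op r • e₂.hom m :=
    key D _ hD (X.basicOpen_le s) r m
  constructor
  · intro m
    obtain ⟨⟨m', c⟩, hm⟩ := h.surj (e₂.inv m)
    obtain ⟨_, n, rfl⟩ := c
    refine ⟨n, e₁.hom m', ?_⟩
    have h₁ : M.presheaf.map (homOfLE (X.basicOpen_le s)).op (e₁.hom m') = e₂.hom (ρ m') :=
      congr($hcomm m')
    have h₂ : ρ m' = (s ^ n) • e₂.inv m := hm.symm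
    rw [h₁, h₂, hs₂, Iso.inv_hom_id_apply, map_pow]
  · intro m hm
    have h₁ : M.presheaf.map (homOfLE (X.basicOpen_le s)).op (e₁.hom (e₁.inv m)) =
        e₂.hom (ρ (e₁.inv m)) := congr($hcomm (e₁.inv m))
    rw [Iso.inv_hom_id_apply, hm] at h₁
    have h₂ : ρ (e₁.inv m) = ρ 0 := by
      have := congr(e₂.inv $h₁)
      rwa [map_zero, Iso.hom_inv_id_apply, eq_comm, ← map_zero ρ.hom] at this
    obtain ⟨⟨_, n, rfl⟩, hn⟩ := h.exists_of_eq h₂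
    refine ⟨n, ?_⟩
    have h₃ : s ^ n • e₁.inv m = 0 := by
      have h₀ : s ^ n • (0 : Γ(N, ⊤)) = 0 := smul_zero _
      exact Eq.trans hn h₀
    have := congr(e₁.hom $h₃)
    rwa [map_zero, hs₁, Iso.inv_hom_id_apply] at this

/-! ### Functions with a single pole -/

/-- The local rings `O P` of a complete curve inside its function field `K`, with uniformizers
`τ P`: every residue field is `k`, and the functions regular everywhere are the constants. -/
structure CurveField (k K ι : Type*) [Field k] [Field K] [Algebra k K] where
  O : ι → Subalgebra k K
  τ : ι → K
  τ_mem (P : ι) : τ P ∈ O P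
  inv_τ_notMem (P : ι) : (τ P)⁻¹ ∉ O P
  exists_const (P : ι) {x : K} : x ∈ O P → ∃ c : k, ∃ y ∈ O P, x = algebraMap k K c + τ P * y
  const {x : K} : (∀ P, x ∈ O P) → ∃ c : k, x = algebraMap k K c

namespace CurveField

variable {k K ι : Type*} [Field k] [Field K] [Algebra k K] (C : CurveField k K ι)

/-- The function `x` vanishes at `P`. -/
def Vanishes (P : ι) (x : K) : Prop := ∃ y ∈ C.O P, x = C.τ P * y

/-- The function `f` has at most a simple pole at `P`, and no other pole. -/
structure PoleLE (P : ι) (f : K) : Prop where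
  τ_mul_mem : C.τ P * f ∈ C.O P
  mem {Q : ι} : Q ≠ P → f ∈ C.O Q

variable {C} {P Q R : ι} {f g x y : K}

lemma τ_ne_zero (P : ι) : C.τ P ≠ 0 := fun h ↦ C.inv_τ_notMem P (by simp [h])

lemma Vanishes.mul_left (hy : C.Vanishes P y) (hx : x ∈ C.O P) : C.Vanishes P (x * y) := by
  obtain ⟨z, hz, rfl⟩ := hy
  exact ⟨x * z, mul_mem hx hz, by ring⟩

lemma Vanishes.sub (hx : C.Vanishes P x) (hy : C.Vanishes P y) : C.Vanishes P (x - y) := by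
  obtain ⟨z, hz, rfl⟩ := hx
  obtain ⟨w, hw, rfl⟩ := hy
  exact ⟨z - w, sub_mem hz hw, by ring⟩

lemma Vanishes.eq_zero {c : k} (h : C.Vanishes P (algebraMap k K c)) : c = 0 := by
  obtain ⟨y, hy, hc⟩ := h
  by_contra h0
  refine C.inv_τ_notMem P ?_
  have hc' : algebraMap k K c ≠ 0 := by simpa using h0
  have hτ := C.τ_ne_zero P
  have : (C.τ P)⁻¹ = algebraMap k K c⁻¹ * y := by
    rw [map_inv₀]; field_simp; rw [hc]
  rw [this]
  exact mul_mem (Subalgebra.algebraMap_mem _ _) hy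

/-- The functions with at most a simple pole at `P` are spanned by `1` and any one of them which
is not regular at `P`. -/
lemma PoleLE.exists_eq (hf : C.PoleLE P f) (hfP : f ∉ C.O P) (hg : C.PoleLE P g) :
    ∃ a b : k, g = algebraMap k K a + algebraMap k K b * f := by
  obtain ⟨c, y, hy, hc⟩ := C.exists_const P hf.τ_mul_mem
  obtain ⟨d, z, hz, hd⟩ := C.exists_const P hg.τ_mul_mem
  have hτ := C.τ_ne_zero P
  have hc0 : c ≠ 0 := by
    rintro rfl
    rw [map_zero, zero_add] at hc
    exact hfP (mul_left_cancel₀ hτ hc ▸ hy)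
  have key : g - algebraMap k K (d / c) * f = z - algebraMap k K (d / c) * y := by
    refine mul_left_cancel₀ hτ ?_
    have : algebraMap k K d = algebraMap k K (d / c) * algebraMap k K c := by
      rw [← map_mul, div_mul_cancel₀ _ hc0]
    linear_combination hd - algebraMap k K (d / c) * hc + this
  obtain ⟨a, ha⟩ := C.const (x := g - algebraMap k K (d / c) * f) fun Q ↦ by
    by_cases hQ : Q = P
    · subst hQ
      rw [key]
      exact sub_mem hz (mul_mem (Subalgebra.algebraMap_mem _ _) hy)
    · exact sub_mem (hg.mem hQ) (mul_mem (Subalgebra.algebraMap_mem _ _) (hf.mem hQ))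
  exact ⟨a, d / c, by rw [← ha]; ring⟩

/-- If for two points there are functions with a simple pole there and no other pole, then a
function with at most a simple pole has at most one zero. -/
lemma PoleLE.eq_zero_of_vanishes (hf : C.PoleLE P f) (hfP : f ∉ C.O P) (hg : C.PoleLE Q g)
    (hgQ : g ∉ C.O Q) (hQ : Q ≠ P) (hQR : R ≠ Q) (hx : C.PoleLE P x)
    (hxQ : C.Vanishes Q x) (hxR : C.Vanishes R x) : x = 0 := by
  obtain ⟨a, b, hab⟩ := hf.exists_eq hfP hx
  -- the zero of `x` at `Q` cancels the pole of `g`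
  have hgx : C.PoleLE P (g * x) := by
    refine ⟨?_, fun {S} hS ↦ ?_⟩
    · rw [mul_left_comm]
      exact mul_mem (hg.mem hQ.symm) hx.τ_mul_mem
    · by_cases hSQ : S = Q
      · subst hSQ
        obtain ⟨y, hy, rfl⟩ := hxQ
        rw [← mul_assoc, mul_comm g]
        exact mul_mem hg.τ_mul_mem hy
      · exact mul_mem (hg.mem hSQ) (hx.mem hS)
  obtain ⟨a', b', hab'⟩ := hf.exists_eq hfP hgx
  rcases eq_or_ne b 0 with rfl | hb
  · rw [map_zero, zero_mul, add_zero] at hab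
    rw [hab] at hxQ ⊢
    rw [hxQ.eq_zero, map_zero]
  have hb' : algebraMap k K b ≠ 0 := by simpa using hb
  have h₁ : g * x - algebraMap k K (b' / b) * x = algebraMap k K (a' - b' / b * a) := by
    rw [hab', hab]
    simp only [map_sub, map_mul, map_div₀]
    field_simp
    ring
  have h₂ : a' - b' / b * a = 0 := by
    refine Vanishes.eq_zero (C := C) (P := R) ?_
    rw [← h₁]
    exact (hxR.mul_left (hg.mem hQR)).sub (hxR.mul_left (Subalgebra.algebraMap_mem _ _))
  rw [h₂, map_zero, ← sub_mul, mul_eq_zero] at h₁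
  refine h₁.resolve_left fun h ↦ hgQ ?_
  rw [sub_eq_zero.1 h]
  exact Subalgebra.algebraMap_mem _ _

end CurveField

/-! ### Coordinates on the ring of functions of an affine curve -/

section Coordinate

variable {k A : Type*} [Field k] [CommRing A] [Algebra k A]

/-- The element `t` is a coordinate on `A`, with coordinate derivation `∂ = d/dt`: the module
`Ω[A⁄k]` is generated by `dt`, and `da = ∂a dt`. -/
structure IsCoordinate (t : A) (δ : Derivation k A A) : Prop where
  apply_self : δ t = 1
  D_eq (a : A) : KaehlerDifferential.D k A a = δ a • KaehlerDifferential.D k A t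

namespace IsCoordinate

variable {t : A} {δ : Derivation k A A}

/-- Every derivation is determined by its value on the coordinate. -/
lemma derivation_eq (h : IsCoordinate t δ) {M : Type*} [AddCommGroup M] [Module A M] [Module k M]
    [IsScalarTower k A M] (ε : Derivation k A M) (a : A) : ε a = δ a • ε t := by
  have := congr(ε.liftKaehlerDifferential $(h.D_eq a))
  simpa using this

/-- To first order at a point, a function vanishing there is a multiple of the coordinate. -/
lemma sub_mem_sq (h : IsCoordinate t δ) (φ : A →ₐ[k] k) {f : A} (hf : φ f = 0) :
    f - δ f * (t - algebraMap k A (φ t)) ∈ RingHom.ker φ ^ 2 := by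
  let m : Ideal A := RingHom.ker φ
  have hm (a : A) : a - algebraMap k A (φ a) ∈ m := by
    simp [m, RingHom.mem_ker]
  -- the derivation sending `a` to the class of `a - a(φ)` in the cotangent space
  let ε : Derivation k A m.Cotangent := Derivation.mk'
    { toFun := fun a ↦ m.toCotangent ⟨_, hm a⟩
      map_add' := fun a b ↦ by
        rw [← map_add]
        congr 1
        ext
        simp only [map_add, Submodule.coe_add]
        ring
      map_smul' := fun c a ↦ by
        rw [RingHom.id_apply, ← algebraMap_smul A c (m.toCotangent _), ← map_smul]
        congr 1
        ext
        simp only [SetLike.val_smul, smul_eq_mul, map_mul, Algebra.smul_def,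
          Algebra.algebraMap_self, RingHom.id_apply, AlgHom.commutes]
        ring } fun a b ↦ by
      change m.toCotangent ⟨_, hm (a * b)⟩ =
        a • m.toCotangent ⟨_, hm b⟩ + b • m.toCotangent ⟨_, hm a⟩
      rw [← map_smul, ← map_smul, ← map_add, Ideal.toCotangent_eq]
      have : a * b - algebraMap k A (φ (a * b)) -
        (a * (b - algebraMap k A (φ b)) + b * (a - algebraMap k A (φ a))) =
        -((a - algebraMap k A (φ a)) * (b - algebraMap k A (φ b))) := by
        rw [map_mul, map_mul]; ring
      simp only [Submodule.coe_add, SetLike.val_smul, smul_eq_mul]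
      rw [this, pow_two]
      exact neg_mem (Ideal.mul_mem_mul (hm a) (hm b))
  have key := h.derivation_eq ε f
  change m.toCotangent ⟨_, hm f⟩ = δ f • m.toCotangent ⟨_, hm t⟩ at key
  rw [← map_smul, Ideal.toCotangent_eq] at key
  simpa [hf] using key

/-- In characteristic zero, differentiating shows that a coordinate is not nilpotent. -/
lemma apply_eq_zero_of_mul_pow_eq_zero [CharZero k] (h : IsCoordinate t δ) (φ : A →ₐ[k] k)
    (n : ℕ) (s : A)
    (hs : s * (t - algebraMap k A (φ t)) ^ n = 0) : φ s = 0 := by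
  induction n generalizing s with
  | zero => simp_all
  | succ n ih =>
    have h₁ := congr(s * δ $hs)
    rw [Derivation.leibniz, Derivation.leibniz_pow, map_sub, h.apply_self, map_zero,
      Derivation.map_algebraMap, Nat.add_sub_cancel] at h₁
    simp only [smul_eq_mul, nsmul_eq_mul, sub_zero, mul_one, mul_zero] at h₁
    have h₂ := ih (s * s * (n + 1 : ℕ)) (by linear_combination h₁ - δ s * hs)
    rw [map_mul, map_mul, map_natCast] at h₂
    have h₃ : ((n + 1 : ℕ) : k) ≠ 0 := Nat.cast_ne_zero.2 (by omega)
    simpa only [mul_eq_zero, h₃, or_false, or_self] using h₂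

variable [IsNoetherianRing A]

/-- Near a point, the coordinate generates the ideal of the point. -/
lemma exists_mul_eq (h : IsCoordinate t δ) (φ : A →ₐ[k] k) :
    ∃ s, φ s ≠ 0 ∧ ∀ f, φ f = 0 → ∃ b, s * f = (t - algebraMap k A (φ t)) * b := by
  have hle : RingHom.ker φ ≤
      Ideal.span {t - algebraMap k A (φ t)} ⊔ RingHom.ker φ • RingHom.ker φ := by
    intro f hf
    rw [← sub_add_cancel f (δ f * (t - algebraMap k A (φ t))), add_comm]
    refine Submodule.add_mem_sup (Ideal.mul_mem_left _ _ (Ideal.mem_span_singleton_self _)) ?_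
    rw [smul_eq_mul, ← pow_two]
    exact h.sub_mem_sq φ hf
  obtain ⟨s, hs, hle⟩ := Submodule.exists_sub_one_mem_and_smul_le_of_fg_of_le_sup
    (IsNoetherian.noetherian (RingHom.ker φ)) le_rfl hle
  refine ⟨s, fun h0 ↦ ?_, fun f hf ↦ ?_⟩
  · simp [RingHom.mem_ker, h0] at hs
  · have := hle (Submodule.smul_mem_pointwise_smul f s _ hf)
    exact Ideal.mem_span_singleton.1 this

variable [CharZero k]

/-- The local rings of a curve with coordinates are domains. -/
lemma isDomain_localization (h : IsCoordinate t δ) (φ : A →ₐ[k] k)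
    [(RingHom.ker φ).IsPrime] : IsDomain (Localization.AtPrime (RingHom.ker φ)) := by
  let m : Ideal A := RingHom.ker φ
  let B := Localization.AtPrime m
  let τ : B := algebraMap A B (t - algebraMap k A (φ t))
  have hτ (n : ℕ) : τ ^ n ≠ 0 := by
    intro h0
    rw [← map_pow] at h0
    obtain ⟨s, hs⟩ := (IsLocalization.map_eq_zero_iff m.primeCompl B _).1 h0
    exact s.2 (h.apply_eq_zero_of_mul_pow_eq_zero φ n s hs)
  have hmax {b : B} (hb : ¬ IsUnit b) : ∃ c, b = τ * c := by
    obtain ⟨s, hs, hmul⟩ := h.exists_mul_eq φ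
    obtain ⟨f, g, rfl⟩ := IsLocalization.exists_mk'_eq m.primeCompl b
    have hf : φ f = 0 := by
      by_contra hf
      exact hb ((IsLocalization.AtPrime.isUnit_mk'_iff B m f g).2 hf)
    obtain ⟨c, hc⟩ := hmul f hf
    have hs' : s ∈ m.primeCompl := hs
    refine ⟨IsLocalization.mk' B c (⟨s, hs'⟩ * g), ?_⟩
    simp only [τ]
    rw [← IsLocalization.mk'_one (M := m.primeCompl) B (t - algebraMap k A (φ t)),
      ← IsLocalization.mk'_mul, ← hc, one_mul,
      mul_comm s f, mul_comm ⟨s, hs'⟩ g]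
    exact (IsLocalization.mk'_cancel f g ⟨s, hs'⟩).symm
  have hτu : ¬ IsUnit τ := by
    rw [IsLocalization.AtPrime.isUnit_to_map_iff B m]
    simp [m, Ideal.primeCompl, RingHom.mem_ker]
  have hpow {b : B} (hb : b ≠ 0) : ∃ (n : ℕ) (u : B), IsUnit u ∧ b = τ ^ n * u := by
    have hne : Ideal.span {τ} ≠ ⊤ := by rwa [Ne, Ideal.span_singleton_eq_top]
    have hex : ∃ n : ℕ, ¬ τ ^ n ∣ b := by
      by_contra! hall
      refine hb ?_
      have : b ∈ (⨅ n : ℕ, Ideal.span {τ} ^ n) := by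
        simp only [Ideal.span_singleton_pow, Ideal.mem_iInf]
        exact fun n ↦ Ideal.mem_span_singleton.2 (hall n)
      rwa [Ideal.iInf_pow_eq_bot_of_isLocalRing _ hne] at this
    classical
    obtain ⟨n, hn⟩ : ∃ n, Nat.find hex = n + 1 := by
      refine Nat.exists_eq_succ_of_ne_zero fun h0 ↦ ?_
      have := Nat.find_spec hex
      simp [h0] at this
    obtain ⟨u, hu⟩ : τ ^ n ∣ b := by
      have := Nat.find_min hex (m := n) (by omega)
      simpa using this
    refine ⟨n, u, ?_, hu⟩
    by_contra hu'
    obtain ⟨c, rfl⟩ := hmax hu'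
    refine (hn ▸ Nat.find_spec hex) ⟨c, ?_⟩
    rw [hu]; ring
  refine @NoZeroDivisors.to_isDomain B _ _ ⟨fun {a b} hab ↦ ?_⟩
  by_contra! h0
  obtain ⟨n, u, hu, rfl⟩ := hpow h0.1
  obtain ⟨n', u', hu', rfl⟩ := hpow h0.2
  refine hτ (n + n') ((hu.mul hu').mul_left_eq_zero.1 ?_)
  rw [← hab]; ring

/-- Zero divisors of a curve with coordinates become trivial near a given point. -/
lemma exists_mul_eq_zero (h : IsCoordinate t δ) (φ : A →ₐ[k] k) :
    ∃ s, φ s ≠ 0 ∧ ∀ a b : A, a * b = 0 → s * a = 0 ∨ s * b = 0 := by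
  have hp : (RingHom.ker φ).IsPrime := RingHom.ker_isPrime φ
  have hdom := h.isDomain_localization φ
  let m : Ideal A := RingHom.ker φ
  let L := Localization.AtPrime m
  let K : Ideal A := RingHom.ker (algebraMap A L)
  obtain ⟨F, hF⟩ : K.FG := IsNoetherian.noetherian K
  have hex (f : F) : ∃ s : m.primeCompl, s * (f : A) = 0 := by
    have : (f : A) ∈ K := hF ▸ Ideal.subset_span f.2
    exact (IsLocalization.map_eq_zero_iff m.primeCompl L _).1 this
  choose σ hσ using hex
  have hs : ∀ f ∈ K, (∏ f, (σ f : A)) * f = 0 := by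
    intro f hf
    rw [← hF] at hf
    refine Submodule.span_induction (fun f hf ↦ ?_) (mul_zero _)
      (fun f g _ _ hf hg ↦ by rw [mul_add, hf, hg, add_zero])
      (fun a f _ hf ↦ by rw [smul_eq_mul, mul_left_comm, hf, mul_zero]) hf
    obtain ⟨c, hc⟩ := Finset.dvd_prod_of_mem (fun f : F ↦ (σ f : A)) (Finset.mem_univ ⟨f, hf⟩)
    rw [hc, mul_right_comm, hσ ⟨f, hf⟩, zero_mul]
  refine ⟨∏ f, (σ f : A), ?_, fun a b hab ↦ ?_⟩
  · rw [map_prod]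
    exact Finset.prod_ne_zero_iff.2 fun f _ ↦ (σ f).2
  · have : algebraMap A L a * algebraMap A L b = 0 := by rw [← map_mul, hab, map_zero]
    exact (mul_eq_zero.1 this).imp (hs a) (hs b)

/-- A point of a curve with coordinates has an affine neighbourhood whose ring is a domain. -/
lemma exists_isDomain_away (h : IsCoordinate t δ) (φ : A →ₐ[k] k) :
    ∃ s, φ s ≠ 0 ∧ ∀ (B : Type w) [CommRing B] [Algebra A B] [IsLocalization.Away s B],
      IsDomain B := by
  obtain ⟨s, hs, hmul⟩ := h.exists_mul_eq_zero φ
  refine ⟨s, hs, fun B _ _ _ ↦ ?_⟩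
  have hB : Nontrivial B := by
    refine ⟨⟨algebraMap A B 1, 0, fun h1 ↦ ?_⟩⟩
    obtain ⟨⟨_, n, rfl⟩, hn⟩ := (IsLocalization.map_eq_zero_iff (.powers s) B 1).1 h1
    have := congr(φ $hn)
    simp [hs] at this
  have h0 {a : A} (ha : s * a = 0) : algebraMap A B a = 0 :=
    (IsLocalization.map_eq_zero_iff (.powers s) B a).2 ⟨⟨s, 1, pow_one s⟩, ha⟩
  refine @NoZeroDivisors.to_isDomain B _ _ ⟨fun {x y} hxy ↦ ?_⟩
  obtain ⟨a, u, rfl⟩ := IsLocalization.exists_mk'_eq (.powers s) x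
  obtain ⟨b, v, rfl⟩ := IsLocalization.exists_mk'_eq (.powers s) y
  rw [← IsLocalization.mk'_mul, IsLocalization.mk'_eq_zero_iff] at hxy
  obtain ⟨⟨_, n, rfl⟩, hn⟩ := hxy
  have hu : IsUnit (algebraMap A B s) := IsLocalization.Away.algebraMap_isUnit s
  rcases hmul (s ^ n * a) b (by rw [mul_assoc]; exact hn) with h₁ | h₁
  · left
    have := h0 h₁
    rw [map_mul, map_pow] at this
    rw [IsLocalization.mk'_eq_zero_iff]
    refine ⟨⟨s ^ (n + 1), n + 1, rfl⟩, ?_⟩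
    linear_combination h₁
  · right
    rw [IsLocalization.mk'_eq_zero_iff]
    exact ⟨⟨s, 1, pow_one s⟩, h₁⟩

end IsCoordinate
end Coordinate

/-! ### Schemes over an algebraically closed field -/

section OverField

variable {k : Type u} [Field k] {C : Scheme.{u}} (s : C ⟶ Spec (.of k))

/-- Restriction of functions to a smaller open set. -/
def rs {U V : C.Opens} (h : V ≤ U) : Γ(C, U) →+* Γ(C, V) := (C.presheaf.map (homOfLE h).op).hom

@[simp] lemma rs_rs {U V W : C.Opens} (h : V ≤ U) (h' : W ≤ V) (f : Γ(C, U)) :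
    rs h' (rs h f) = rs (h'.trans h) f := by
  simp only [rs, ← ConcreteCategory.comp_apply, ← Functor.map_comp]
  rfl

@[simp] lemma rs_refl {U : C.Opens} (f : Γ(C, U)) : rs le_rfl f = f := by simp [rs]

@[simp] lemma basicOpen_rs {U V : C.Opens} (h : V ≤ U) (f : Γ(C, U)) :
    C.basicOpen (rs h f) = V ⊓ C.basicOpen f := C.basicOpen_res f (homOfLE h).op

lemma isUnit_rs_basicOpen {U : C.Opens} (f : Γ(C, U)) : IsUnit (rs (C.basicOpen_le f) f) :=
  RingedSpace.isUnit_res_basicOpen _ f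

lemma isUnit_rs {U V : C.Opens} (h : V ≤ U) (f : Γ(C, U)) (hf : V ≤ C.basicOpen f) :
    IsUnit (rs h f) := by
  rw [← rs_rs (C.basicOpen_le f) hf]
  exact (isUnit_rs_basicOpen f).map _

/-- Functions which agree locally are equal. -/
lemma eq_of_locally_eq {U : C.Opens} {f g : Γ(C, U)}
    (h : ∀ x ∈ U, ∃ (V : C.Opens) (hV : V ≤ U), x ∈ V ∧ rs hV f = rs hV g) : f = g := by
  choose V hV hxV hfg using fun x : U ↦ h x.1 x.2
  exact C.sheaf.eq_of_locally_eq' V U (fun x ↦ homOfLE (hV x))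
    (fun x hx ↦ Opens.mem_iSup.2 ⟨⟨x, hx⟩, hxV _⟩) f g hfg

/-- Functions which are compatible on overlaps glue. -/
lemma exists_glue {ι : Type*} {U : C.Opens} (V : ι → C.Opens) (hV : ∀ i, V i ≤ U)
    (hU : ∀ x ∈ U, ∃ i, x ∈ V i) (f : ∀ i, Γ(C, V i))
    (hf : ∀ i j, rs (inf_le_left : V i ⊓ V j ≤ V i) (f i) = rs inf_le_right (f j)) :
    ∃ g : Γ(C, U), ∀ i, rs (hV i) g = f i :=
  (C.sheaf.existsUnique_gluing' V U (fun i ↦ homOfLE (hV i))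
    (fun x hx ↦ Opens.mem_iSup.2 (hU x hx)) f hf).exists

lemma isLocalization_rs {U : C.Opens} (hU : IsAffineOpen U) (f : Γ(C, U)) :
    letI := (rs (C.basicOpen_le f)).toAlgebra
    IsLocalization.Away f Γ(C, C.basicOpen f) := hU.isLocalization_basicOpen f

lemma exists_pow_mul_eq_rs {U : C.Opens} (hU : IsAffineOpen U) (f : Γ(C, U))
    (g : Γ(C, C.basicOpen f)) :
    ∃ (n : ℕ) (a : Γ(C, U)), rs (C.basicOpen_le f) f ^ n * g = rs (C.basicOpen_le f) a := by
  let := (rs (C.basicOpen_le f)).toAlgebra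
  have := isLocalization_rs hU f
  obtain ⟨n, a, h⟩ := IsLocalization.Away.surj f g
  refine ⟨n, a, ?_⟩
  rw [mul_comm]
  exact h

/-- The constant functions. -/
def constant (U : C.Opens) : k →+* Γ(C, U) :=
  ((C.presheaf.map (homOfLE le_top).op).hom.comp s.appTop.hom).comp
    (Scheme.ΓSpecIso (.of k)).inv.hom

@[simp] lemma rs_constant {U V : C.Opens} (h : V ≤ U) (c : k) :
    rs h (constant s U c) = constant s V c := rs_rs le_top h _

section Eval

variable [IsAlgClosed k] [LocallyOfFiniteType s] {x : C} (hx : IsClosed {x})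

/-- The value of a function at a closed point. -/
def evalAt {U : C.Opens} (hxU : x ∈ U) : Γ(C, U) →+* k :=
  ((pointOfClosedPoint s x hx).appLE U ⊤ (fun y _ ↦ by
    change pointOfClosedPoint s x hx y ∈ U
    simpa using hxU) ≫ (Scheme.ΓSpecIso (.of k)).hom).hom

@[simp] lemma evalAt_constant {U : C.Opens} (hxU : x ∈ U) (c : k) :
    evalAt s hx hxU (constant s U c) = c := by
  have : (Scheme.ΓSpecIso (.of k)).inv ≫ s.appTop ≫ C.presheaf.map (homOfLE le_top).op ≫
      (pointOfClosedPoint s x hx).appLE U ⊤ (fun y _ ↦ by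
    change pointOfClosedPoint s x hx y ∈ U
    simpa using hxU) ≫ (Scheme.ΓSpecIso (.of k)).hom = 𝟙 _ := by
    have h : s.appTop ≫ (pointOfClosedPoint s x hx).appLE ⊤ ⊤ le_top = 𝟙 _ := by
      have h₁ := Scheme.Hom.appLE_comp_appLE (pointOfClosedPoint s x hx) s ⊤ ⊤ ⊤ le_top le_top
      simp only [pointOfClosedPoint_comp] at h₁
      rw [Scheme.Hom.appTop, Scheme.Hom.app_eq_appLE]
      refine h₁.trans ?_
      simp only [Scheme.Hom.appLE, Scheme.Hom.id_app]
      exact (Spec (.of k)).presheaf.map_id _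
    rw [Scheme.Hom.map_appLE_assoc, reassoc_of% h, Iso.inv_hom_id]
  exact congr($this c)

lemma evalAt_eq_zero_iff {U : C.Opens} (hxU : x ∈ U) (f : Γ(C, U)) :
    evalAt s hx hxU f = 0 ↔ x ∉ C.basicOpen f := by
  let p := pointOfClosedPoint s x hx
  have hp (y) : p y = x := pointOfClosedPoint_apply s x hx y
  have hle : ⊤ ≤ p ⁻¹ᵁ U := fun y _ ↦ by
    change p y ∈ U
    rwa [hp]
  let y : Spec (.of k) := IsLocalRing.closedPoint k
  have hb : x ∈ C.basicOpen f ↔ y ∈ (Spec (.of k)).basicOpen (p.appLE U ⊤ hle f) := by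
    rw [Scheme.basicOpen_appLE, top_inf_eq, ← hp y]
    rfl
  let a : k := (Scheme.ΓSpecIso (.of k)).hom (p.appLE U ⊤ hle f)
  have ha : p.appLE U ⊤ hle f = (Scheme.ΓSpecIso (.of k)).inv a := by simp [a]
  change a = 0 ↔ _
  rw [hb, ha]
  constructor
  · intro h0
    simp [h0]
  · contrapose!
    intro h0
    have : IsUnit ((Scheme.ΓSpecIso (.of k)).inv a) := (IsUnit.mk0 a h0).map _
    rw [Scheme.basicOpen_of_isUnit _ this]
    trivial

@[simp] lemma evalAt_rs {U V : C.Opens} (h : V ≤ U) (hxV : x ∈ V) (f : Γ(C, U)) :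
    evalAt s hx hxV (rs h f) = evalAt s hx (h hxV) f := by
  have : C.presheaf.map (homOfLE h).op ≫ (pointOfClosedPoint s x hx).appLE V ⊤ (fun y _ ↦ by
    change pointOfClosedPoint s x hx y ∈ V
    simpa using hxV) = (pointOfClosedPoint s x hx).appLE U ⊤ (fun y _ ↦ by
    change pointOfClosedPoint s x hx y ∈ U
    simpa using h hxV) := Scheme.Hom.map_appLE _ _ _
  exact congr((Scheme.ΓSpecIso (.of k)).hom ($this f))

end Eval
end OverField

/-! ### Smooth curves are integral -/

section Coord

variable {k : Type u} [Field k] {C : Scheme.{u}} (s : C ⟶ Spec (.of k))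

/-- The function `t` is a coordinate on `U`, with coordinate derivation `d = d/dt`, with respect
to the `k`-algebra structure on `Γ(C, U)` coming from the structure morphism `s`. -/
def IsCoord {U : C.Opens} (t : Γ(C, U)) (d : Γ(C, U) →+ Γ(C, U)) : Prop :=
  letI := (constant s U).toAlgebra
  ∃ δ : Derivation k Γ(C, U) Γ(C, U), (∀ a, δ a = d a) ∧ IsCoordinate t δ

namespace IsCoord

variable {s} {U : C.Opens} {t : Γ(C, U)} {d : Γ(C, U) →+ Γ(C, U)}

lemma apply_self (h : IsCoord s t d) : d t = 1 := by
  let := (constant s U).toAlgebra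
  obtain ⟨δ, hδ, h⟩ := h
  rw [← hδ, h.apply_self]

/-- A derivation along a ring homomorphism is determined by its value on the coordinate. -/
lemma derivation_eq (h : IsCoord s t d) {B : Type*} [CommRing B] (ρ : Γ(C, U) →+* B)
    (ε : Γ(C, U) →+ B) (hmul : ∀ a b, ε (a * b) = ρ a * ε b + ρ b * ε a)
    (hc : ∀ c, ε (constant s U c) = 0) (a : Γ(C, U)) : ε a = ρ (d a) * ε t := by
  let := (constant s U).toAlgebra
  let := (ρ.comp (constant s U)).toAlgebra
  let := ρ.toAlgebra
  have : IsScalarTower k Γ(C, U) B := .of_algebraMap_eq' rfl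
  obtain ⟨δ, hδ, h⟩ := h
  let ε' : Derivation k Γ(C, U) B := Derivation.mk'
    { toFun := ε
      map_add' := map_add ε
      map_smul' := fun c a ↦ by
        rw [Algebra.smul_def, hmul, RingHom.id_apply, Algebra.smul_def]
        change ρ (constant s U c) * ε a + ρ a * ε (constant s U c) = ρ (constant s U c) * ε a
        rw [hc, mul_zero, add_zero] } hmul
  rw [← hδ]
  exact h.derivation_eq ε' a

lemma isNoetherianRing (s : C ⟶ Spec (.of k)) [LocallyOfFiniteType s] {U : C.Opens}
    (hU : IsAffineOpen U) : IsNoetherianRing Γ(C, U) := by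
  have : IsLocallyNoetherian C := LocallyOfFiniteType.isLocallyNoetherian s
  exact IsLocallyNoetherian.component_noetherian ⟨U, hU⟩

variable [IsAlgClosed k] [LocallyOfFiniteType s] {x : C}

/-- Near a point, the ideal of the point is generated by the coordinate. -/
lemma exists_mul_eq (h : IsCoord s t d) (hU : IsAffineOpen U) (hx : IsClosed {x}) (hxU : x ∈ U) :
    ∃ r, x ∈ C.basicOpen r ∧ ∀ f, evalAt s hx hxU f = 0 →
      ∃ b, r * f = (t - constant s U (evalAt s hx hxU t)) * b := by
  have := isNoetherianRing s hU
  let := (constant s U).toAlgebra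
  let φ : Γ(C, U) →ₐ[k] k := ⟨evalAt s hx hxU, evalAt_constant s hx hxU⟩
  obtain ⟨δ, hδ, h⟩ := h
  obtain ⟨r, hr, h⟩ := h.exists_mul_eq φ
  exact ⟨r, not_not.1 fun h0 ↦ hr ((evalAt_eq_zero_iff s hx hxU r).2 h0), h⟩

/-- A closed point with a coordinate has an affine neighbourhood whose ring is a domain. -/
lemma exists_isDomain [CharZero k] (h : IsCoord s t d) (hU : IsAffineOpen U) (hx : IsClosed {x})
    (hxU : x ∈ U) : ∃ r : Γ(C, U), x ∈ C.basicOpen r ∧ IsDomain Γ(C, C.basicOpen r) := by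
  have := isNoetherianRing s hU
  let := (constant s U).toAlgebra
  let φ : Γ(C, U) →ₐ[k] k := ⟨evalAt s hx hxU, evalAt_constant s hx hxU⟩
  obtain ⟨δ, hδ, h⟩ := h
  obtain ⟨r, hr, h⟩ := h.exists_isDomain_away φ
  let := (rs (C.basicOpen_le r)).toAlgebra
  have := isLocalization_rs hU r
  exact ⟨r, not_not.1 fun h0 ↦ hr ((evalAt_eq_zero_iff s hx hxU r).2 h0), h _⟩

end IsCoord

lemma exists_isClosed_specializes [CompactSpace C] (x : C) : ∃ y : C, IsClosed {y} ∧ x ⤳ y := by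
  obtain ⟨y, hy, hy'⟩ := (isClosed_closure (s := {x})).exists_closed_singleton
    ⟨x, subset_closure rfl⟩
  exact ⟨y, hy', specializes_iff_mem_closure.2 hy⟩

/-- A connected scheme covered by affine open sets whose rings are domains is integral. -/
lemma isIntegral_of_isDomain [ConnectedSpace C]
    (h : ∀ x : C, ∃ U : C.Opens, x ∈ U ∧ IsAffineOpen U ∧ IsDomain Γ(C, U)) : IsIntegral C := by
  have hint (x : C) : ∃ U : C.Opens, x ∈ U ∧ IsIntegral U.toScheme := by
    obtain ⟨U, hxU, hU, hdom⟩ := h x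
    have : Nonempty U := ⟨⟨x, hxU⟩⟩
    exact ⟨U, hxU, isIntegral_of_isOpenImmersion hU.isoSpec.hom⟩
  have : IsReduced C := by
    refine ⟨fun V ↦ ⟨fun f hf ↦ eq_of_locally_eq fun x hx ↦ ?_⟩⟩
    obtain ⟨U, hxU, hU⟩ := hint x
    have hred : _root_.IsReduced Γ(C, U.ι ''ᵁ U.ι ⁻¹ᵁ V) :=
      inferInstanceAs (_root_.IsReduced Γ(U.toScheme, U.ι ⁻¹ᵁ V))
    rw [Scheme.Hom.image_preimage_eq_opensRange_inf, Scheme.Opens.opensRange_ι] at hred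
    exact ⟨U ⊓ V, inf_le_right, ⟨hxU, hx⟩, by rw [map_zero]; exact (hf.map _).eq_zero⟩
  -- the closure of a nonempty open set is open, hence everything
  have hdense {V : Set C} (hV : IsOpen V) (hne : V.Nonempty) : closure V = Set.univ := by
    refine IsClopen.eq_univ ⟨isClosed_closure, isOpen_iff_forall_mem_open.2 fun x hx ↦ ?_⟩
      hne.closure
    obtain ⟨U, hxU, hU⟩ := hint x
    refine ⟨U, ?_, U.2, hxU⟩
    have hirr : IsPreirreducible (U : Set C) :=
      isPreirreducible_iff_preirreducibleSpace.2 (inferInstanceAs (PreirreducibleSpace U.toScheme))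
    obtain ⟨z, hzU, hzV⟩ := mem_closure_iff.1 hx U U.2 hxU
    refine (subset_closure_inter_of_isPreirreducible_of_isOpen hirr hV ⟨z, hzU, hzV⟩).trans
      (closure_mono Set.inter_subset_right)
  have : PreirreducibleSpace C := by
    refine PreirreducibleSpace.of_forall_nonempty_inter fun V W hV hW hVne ⟨x, hx⟩ ↦ ?_
    have hx' : x ∈ closure V := hdense hV hVne ▸ Set.mem_univ x
    obtain ⟨z, hzW, hzV⟩ := mem_closure_iff.1 hx' W hW hx
    exact ⟨z, hzV, hzW⟩
  have : IrreducibleSpace C := ⟨inferInstance⟩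
  exact isIntegral_of_irreducibleSpace_of_isReduced C

theorem isIntegral_of_isCoord [IsAlgClosed k] [CharZero k] [IsProper s] [ConnectedSpace C]
    (h : ∀ x : C, ∃ U : C.Opens, x ∈ U ∧ IsAffineOpen U ∧ ∃ (t : Γ(C, U)) (d : _), IsCoord s t d) :
    IsIntegral C := by
  have : CompactSpace C := compactSpace_of_universallyClosed s
  refine isIntegral_of_isDomain fun x ↦ ?_
  obtain ⟨y, hy, hxy⟩ := exists_isClosed_specializes x
  obtain ⟨U, hyU, hU, t, d, htd⟩ := h y
  obtain ⟨r, hr, hdom⟩ := htd.exists_isDomain hU hy hyU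
  exact ⟨C.basicOpen r, hxy.mem_open (C.basicOpen r).2 hr, hU.basicOpen r, hdom⟩

end Coord

/-! ### The function field of an integral curve -/

section FunctionField

/-- Derivations of a domain extend to its field of fractions. -/
lemma exists_derivation_of_isFractionRing {k A K : Type*} [Field k] [CommRing A] [Field K]
    [Algebra k A] [Algebra A K] [Algebra k K] [IsScalarTower k A K] [IsFractionRing A K]
    (δ : Derivation k A A) :
    ∃ ε : Derivation k K K, ∀ a, ε (algebraMap A K a) = algebraMap A K (δ a) := by
  have hu (x : nonZeroDivisors A) : IsUnit (algebraMap A (Module.End A K) x) := by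
    rw [Module.End.isUnit_iff]
    have hx : algebraMap A K x ≠ 0 := (IsLocalization.map_units K x).ne_zero
    refine ⟨fun a b hab ↦ ?_, fun a ↦ ⟨(algebraMap A K x)⁻¹ * a, ?_⟩⟩
    · simpa [Algebra.smul_def, hx] using hab
    · simp [Algebra.smul_def, hx]
  let l := IsLocalizedModule.lift (nonZeroDivisors A) (KaehlerDifferential.map k k A K)
    ((Algebra.linearMap A K).comp δ.liftKaehlerDifferential) hu
  let l' := LinearMap.extendScalarsOfIsLocalization (nonZeroDivisors A) K l
  refine ⟨l'.compDer (KaehlerDifferential.D k K), fun a ↦ ?_⟩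
  have := LinearMap.congr_fun (IsLocalizedModule.lift_comp (nonZeroDivisors A)
    (KaehlerDifferential.map k k A K)
    ((Algebra.linearMap A K).comp δ.liftKaehlerDifferential) hu) (KaehlerDifferential.D k A a)
  change l _ = _
  simpa using this

variable {C : Scheme.{u}}

lemma nonempty_of_mem {U : C.Opens} {x : C} (hx : x ∈ U) : (U : Set C).Nonempty := ⟨x, hx⟩

variable [IsIntegral C]

/-- The embedding of the functions on a nonempty open set into the function field. -/
def toK (U : C.Opens) (hU : (U : Set C).Nonempty) : Γ(C, U) →+* C.functionField :=
  (C.presheaf.germ U (genericPoint C)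
    (((genericPoint_spec C).mem_open_set_iff U.isOpen).mpr (by simpa using hU))).hom

lemma toK_rs {U V : C.Opens} (h : V ≤ U) (hV : (V : Set C).Nonempty) (a : Γ(C, U)) :
    toK V hV (rs h a) = toK U (hV.mono h) a :=
  TopCat.Presheaf.germ_res_apply' _ _ _ _ _

lemma toK_injective (U : C.Opens) (hU : (U : Set C).Nonempty) : Function.Injective (toK U hU) :=
  germ_injective_of_isIntegral C _ _

/-- The local ring of `C` at `x`, as a subring of the function field. -/
def localSubring (x : C) : Subring C.functionField :=
  (algebraMap (C.presheaf.stalk x) C.functionField).range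

lemma toK_mem {U : C.Opens} {x : C} (hx : x ∈ U) (a : Γ(C, U)) :
    toK U (nonempty_of_mem hx) a ∈ localSubring x := by
  have : Nonempty U := ⟨⟨x, hx⟩⟩
  exact ⟨C.presheaf.germ U x hx a, Scheme.algebraMap_germ_eq_germToFunctionField C hx a⟩

lemma exists_toK_eq {x : C} {f : C.functionField} (hf : f ∈ localSubring x) :
    ∃ (U : C.Opens) (hx : x ∈ U) (a : Γ(C, U)), toK U (nonempty_of_mem hx) a = f := by
  obtain ⟨y, rfl⟩ := hf
  obtain ⟨U, hx, a, rfl⟩ := C.presheaf.exists_germ_eq y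
  have : Nonempty U := ⟨⟨x, hx⟩⟩
  exact ⟨U, hx, a, (Scheme.algebraMap_germ_eq_germToFunctionField C hx a).symm⟩

/-- A rational function which is regular at every point of an open set is a function on it. -/
lemma exists_toK_eq_of_forall_mem {V : C.Opens} (hV : (V : Set C).Nonempty) {f : C.functionField}
    (hf : ∀ x ∈ V, f ∈ localSubring x) : ∃ a : Γ(C, V), toK V hV a = f := by
  choose U hU a ha using fun x : V ↦ exists_toK_eq (hf x.1 x.2)
  obtain ⟨g, hg⟩ := exists_glue (U := V) (fun x : V ↦ V ⊓ U x) (fun _ ↦ inf_le_left)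
    (fun x hx ↦ ⟨⟨x, hx⟩, hx, hU _⟩) (fun x ↦ rs inf_le_right (a x)) fun x y ↦ by
      rcases Set.eq_empty_or_nonempty (((V ⊓ U x) ⊓ (V ⊓ U y) : C.Opens) : Set C) with h | h
      · exact eq_of_locally_eq fun z hz ↦ absurd (show z ∈ (∅ : Set C) from h ▸ hz) (by simp)
      · apply toK_injective _ h
        rw [rs_rs, rs_rs, toK_rs, toK_rs, ha, ha]
  obtain ⟨x, hx⟩ := hV
  refine ⟨g, ?_⟩
  have := congr(toK (V ⊓ U ⟨x, hx⟩) ⟨x, hx, hU _⟩ $(hg ⟨x, hx⟩))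
  exact (toK_rs _ _ _).symm.trans (this.trans ((toK_rs _ _ _).trans (ha _)))

lemma isFractionRing_toK {U : C.Opens} (hU : IsAffineOpen U) (hne : (U : Set C).Nonempty) :
    letI := (toK U hne).toAlgebra
    IsFractionRing Γ(C, U) C.functionField := by
  have : Nonempty U := hne.to_subtype
  exact functionField_isFractionRing_of_isAffineOpen C U hU

lemma localSubring_mono {x y : C} (h : x ⤳ y) : localSubring y ≤ localSubring x := by
  intro f hf
  obtain ⟨U, hy, a, rfl⟩ := exists_toK_eq hf
  exact toK_mem (h.mem_open U.2 hy) a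

/-- The functions on a complete integral curve are constant. -/
lemma exists_constant_eq {k : Type u} [Field k] [IsAlgClosed k] (s : C ⟶ Spec (.of k))
    [IsProper s] (a : Γ(C, ⊤)) : ∃ c, a = constant s ⊤ c := by
  have h : (s.appTop.hom.comp (Scheme.ΓSpecIso (.of k)).inv.hom).IsIntegral :=
    RingHom.isIntegral_respectsIso.2 _ (Scheme.ΓSpecIso (.of k)).symm.commRingCatIsoToRingEquiv
      (isIntegral_appTop_of_universallyClosed s)
  obtain ⟨c, hc⟩ := (IsAlgClosed.ringHom_bijective_of_isIntegral _ h).2 a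
  exact ⟨c, by rw [← hc]; exact (rs_refl (C := C) _).symm⟩

end FunctionField

/-! ### Derivations of the structure sheaf -/

section SheafDerivation

variable {k : Type u} [Field k] {C : Scheme.{u}}

/-- A `k`-linear derivation of the structure sheaf over `U`. -/
structure SheafDerivation (s : C ⟶ Spec (.of k)) (U : C.Opens) where
  app (V : C.Opens) (h : V ≤ U) : Γ(C, V) →+ Γ(C, V)
  map_constant {V : C.Opens} (h : V ≤ U) (c : k) : app V h (constant s V c) = 0
  leibniz {V : C.Opens} (h : V ≤ U) (a b : Γ(C, V)) :
    app V h (a * b) = a * app V h b + b * app V h a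
  rs_app {V W : C.Opens} (hV : V ≤ U) (hW : W ≤ V) (a : Γ(C, V)) :
    rs hW (app V hV a) = app W (hW.trans hV) (rs hW a)

variable {s : C ⟶ Spec (.of k)}

/-- The coordinate derivation extends to a derivation of the structure sheaf. -/
lemma IsCoord.exists_sheafDerivation [IsIntegral C] {U : C.Opens} {t : Γ(C, U)}
    {d : Γ(C, U) →+ Γ(C, U)} (h : IsCoord s t d) (hU : IsAffineOpen U) :
    ∃ δ : SheafDerivation s U, ∀ a, δ.app U le_rfl a = d a := by
  rcases Set.eq_empty_or_nonempty (U : Set C) with h0 | hne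
  · have hsub {V : C.Opens} (hV : V ≤ U) (a b : Γ(C, V)) : a = b :=
      eq_of_locally_eq fun z hz ↦ absurd (show z ∈ (∅ : Set C) from h0 ▸ hV hz) (by simp)
    exact ⟨⟨fun _ _ ↦ 0, fun _ _ ↦ rfl, fun h _ _ ↦ hsub h _ _, fun _ _ _ ↦ map_zero _⟩,
      fun a ↦ hsub le_rfl _ _⟩
  let := (constant s U).toAlgebra
  let := (toK U hne).toAlgebra
  let := ((toK U hne).comp (constant s U)).toAlgebra
  have : IsScalarTower k Γ(C, U) C.functionField := .of_algebraMap_eq' rfl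
  have := isFractionRing_toK hU hne
  obtain ⟨δ, hδ, h⟩ := h
  obtain ⟨ε, hε⟩ := exists_derivation_of_isFractionRing (K := C.functionField) δ
  have hε (a) : ε (toK U hne a) = toK U hne (d a) := (hε a).trans congr(toK U hne $(hδ a))
  -- the derivation of the function field preserves the local rings
  have hmem {x : C} (hx : x ∈ U) {f : C.functionField} (hf : f ∈ localSubring x) :
      ε f ∈ localSubring x := by
    obtain ⟨V, hxV, a, rfl⟩ := exists_toK_eq hf
    obtain ⟨r, hrV, hxr⟩ := hU.exists_basicOpen_le ⟨x, hxV⟩ hx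
    have hle := C.basicOpen_le r
    obtain ⟨n, b, hb⟩ := exists_pow_mul_eq_rs hU r (rs hrV a)
    have hner : (C.basicOpen r : Set C).Nonempty := ⟨x, hxr⟩
    have hb' := congr(toK _ hner $hb)
    rw [map_mul, map_pow, toK_rs, toK_rs, toK_rs] at hb'
    have hb'' := congr(ε $hb')
    rw [Derivation.leibniz, hε, ← map_pow, hε, smul_eq_mul, smul_eq_mul] at hb''
    have hu := (isUnit_rs_basicOpen r).pow n
    obtain ⟨c, hc⟩ := hu.exists_right_inv
    have hc' := congr(toK _ hner $hc)
    rw [map_mul, ← map_pow, toK_rs, map_one] at hc'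
    have : ε (toK V (nonempty_of_mem hxV) a) = toK _ hner c *
        (toK U hne (d b) - toK V (nonempty_of_mem hxV) a * toK U hne (d (r ^ n))) := by
      rw [← hb'']; linear_combination (-ε (toK V (nonempty_of_mem hxV) a)) * hc'
    rw [this]
    exact mul_mem (toK_mem hxr c)
      (sub_mem (toK_mem hx _) (mul_mem (toK_mem hxV _) (toK_mem hx _)))
  have key {V : C.Opens} (hV : V ≤ U) (hne' : (V : Set C).Nonempty) (a : Γ(C, V)) :
      ∃ b, toK V hne' b = ε (toK V hne' a) :=
    exists_toK_eq_of_forall_mem hne' fun x hx ↦ hmem (hV hx) (toK_mem hx a)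
  have key' (V : C.Opens) (hV : V ≤ U) : ∃ φ : Γ(C, V) →+ Γ(C, V), ∀ hne' a,
      toK V hne' (φ a) = ε (toK V hne' a) := by
    rcases Set.eq_empty_or_nonempty (V : Set C) with h0 | hne'
    · exact ⟨0, fun h ↦ absurd h0 h.ne_empty⟩
    choose φ hφ using key hV hne'
    refine ⟨⟨⟨φ, ?_⟩, ?_⟩, fun _ ↦ hφ⟩
    · apply toK_injective _ hne'; simp [hφ]
    · intro a b; apply toK_injective _ hne'; simp [hφ]
  choose φ hφ using key'
  have hext {V : C.Opens} {a b : Γ(C, V)} (hab : ∀ hne', toK V hne' a = toK V hne' b) : a = b := by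
    rcases Set.eq_empty_or_nonempty (V : Set C) with h0 | hne'
    · exact eq_of_locally_eq fun z hz ↦ absurd (show z ∈ (∅ : Set C) from h0 ▸ hz) (by simp)
    · exact toK_injective _ hne' (hab hne')
  refine ⟨⟨φ, fun hV c ↦ hext fun hne' ↦ ?_, fun hV a b ↦ hext fun hne' ↦ ?_,
    fun hV hW a ↦ hext fun hne' ↦ ?_⟩, fun a ↦ hext fun hne' ↦ ?_⟩
  · rw [hφ, ← rs_constant s hV, toK_rs, map_zero]
    exact ε.map_algebraMap c
  · simp [hφ]
  · rw [toK_rs, hφ, hφ, toK_rs]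
  · exact (hφ _ _ _ _).trans (hε a)

/-- A derivation of the structure sheaf is a multiple of the coordinate derivation. -/
lemma IsCoord.sheafDerivation_eq {U : C.Opens} {t : Γ(C, U)}
    {d : Γ(C, U) →+ Γ(C, U)} (h : IsCoord s t d) (hU : IsAffineOpen U) (δ : SheafDerivation s U)
    (hδ : ∀ a, δ.app U le_rfl a = d a) {W : C.Opens} (hW : W ≤ U) (ε : SheafDerivation s W)
    {V : C.Opens} (hV : V ≤ W) (a : Γ(C, V)) :
    ε.app V hV a = rs hV (ε.app W le_rfl (rs hW t)) * δ.app V (hV.trans hW) a := by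
  refine eq_of_locally_eq fun x hx ↦ ?_
  obtain ⟨r, hrV, hxr⟩ := hU.exists_basicOpen_le ⟨x, hx⟩ (hW (hV hx))
  refine ⟨_, hrV, hxr, ?_⟩
  have hr : C.basicOpen r ≤ W := hrV.trans hV
  have hle := C.basicOpen_le r
  obtain ⟨n, b, hb⟩ := exists_pow_mul_eq_rs hU r (rs hrV a)
  simp only [map_mul, rs_rs, ε.rs_app, δ.rs_app]
  set a' := rs hrV a
  have hub (b : Γ(C, U)) : ε.app _ hr (rs hle b) =
      ε.app _ hr (rs hle t) * δ.app _ hle (rs hle b) := by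
    have := h.derivation_eq (rs hle) ((ε.app _ hr).comp (rs hle).toAddMonoidHom)
      (fun a b ↦ by simp [ε.leibniz]) (fun c ↦ by simp [ε.map_constant]) b
    rw [← δ.rs_app le_rfl, hδ, mul_comm]
    exact this
  have e₁ := congr(ε.app _ hr $hb)
  have e₂ := congr(δ.app _ hle $hb)
  rw [hub, ← e₂, ← map_pow, ε.leibniz, δ.leibniz, hub] at e₁
  refine (((isUnit_rs_basicOpen r).map (powMonoidHom n))).mul_left_cancel ?_
  simp only [powMonoidHom_apply, ← map_pow]
  linear_combination e₁

end SheafDerivation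

/-! ### Vector fields on curves of genus zero -/

section GenusZero

variable {k : Type u} [Field k] [IsAlgClosed k] {C : Scheme.{u}}

/-- The Čech cohomology of the structure sheaf vanishes in degree one for all coverings by two open
sets. -/
def SplitsOnPairs (C : Scheme.{u}) : Prop :=
  ∀ (U V : C.Opens), U ⊔ V = ⊤ → ∀ a : Γ(C, U ⊓ V), ∃ (b : Γ(C, U)) (c : Γ(C, V)),
    rs inf_le_left b - rs inf_le_right c = a

/-- Near the closed point `P`, the function `τ` on the affine open set `U` generates the ideal
of `P`, and `δ` is a frame of the tangent bundle which is dual to `dτ`. -/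
structure IsUniformizer (s : C ⟶ Spec (.of k)) [LocallyOfFiniteType s] {P : C}
    (hP : IsClosed {P}) {U : C.Opens} (hPU : P ∈ U) (τ : Γ(C, U)) (δ : SheafDerivation s U) :
    Prop where
  isAffineOpen : IsAffineOpen U
  exists_eq_mul (f : Γ(C, U)) : evalAt s hP hPU f = 0 → ∃ b, f = τ * b
  eval_eq_zero : evalAt s hP hPU τ = 0
  apply_self : δ.app U le_rfl τ = 1
  derivation_eq (ε : SheafDerivation s U) {V : C.Opens} (hV : V ≤ U) (a : Γ(C, V)) :
    ε.app V hV a = rs hV (ε.app U le_rfl τ) * δ.app V hV a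

namespace SheafDerivation

variable {s : C ⟶ Spec (.of k)}

/-- Restriction of derivations. -/
def restrict {U V : C.Opens} (h : V ≤ U) (δ : SheafDerivation s U) : SheafDerivation s V where
  app W hW := δ.app W (hW.trans h)
  map_constant hW := δ.map_constant (hW.trans h)
  leibniz hW := δ.leibniz (hW.trans h)
  rs_app hV hW a := δ.rs_app (hV.trans h) hW a

/-- A vector field on `C` vanishes at the closed point `P`. -/
def VanishesAt [LocallyOfFiniteType s] (v : SheafDerivation s ⊤) {P : C} (hP : IsClosed {P}) :
    Prop :=
  ∀ (V : C.Opens) (hPV : P ∈ V) (a : Γ(C, V)), evalAt s hP hPV (v.app V le_top a) = 0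

end SheafDerivation

variable {s : C ⟶ Spec (.of k)}

/-- A coordinate, up to a constant and on a smaller neighbourhood, is a uniformizer. -/
lemma exists_isUniformizer [CharZero k] [IsIntegral C] [LocallyOfFiniteType s]
    (h : ∀ x : C, ∃ U : C.Opens, x ∈ U ∧ IsAffineOpen U ∧ ∃ (t : Γ(C, U)) (d : _), IsCoord s t d)
    {P : C} (hP : IsClosed {P}) :
    ∃ (U : C.Opens) (hPU : P ∈ U) (τ : Γ(C, U)) (δ : SheafDerivation s U),
      IsUniformizer s hP hPU τ δ := by
  obtain ⟨U, hPU, hU, t, d, htd⟩ := h P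
  obtain ⟨r, hPr, hr⟩ := htd.exists_mul_eq hU hP hPU
  obtain ⟨δ, hδ⟩ := htd.exists_sheafDerivation hU
  have hle := C.basicOpen_le r
  refine ⟨C.basicOpen r, hPr, rs hle (t - constant s U (evalAt s hP hPU t)),
    δ.restrict hle, hU.basicOpen r, fun f hf ↦ ?_, by simp, ?_, fun ε V hV a ↦ ?_⟩
  · obtain ⟨n, a, ha⟩ := exists_pow_mul_eq_rs hU r f
    have ha0 : evalAt s hP hPU a = 0 := by
      rw [← evalAt_rs s hP hle hPr, ← ha, map_mul, hf, mul_zero]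
    obtain ⟨b, hb⟩ := hr a ha0
    obtain ⟨c, hc⟩ := ((isUnit_rs_basicOpen r).pow (n + 1)).exists_right_inv
    refine ⟨rs hle b * c, ?_⟩
    rw [← mul_assoc, ← map_mul, ← hb, map_mul, ← ha]
    linear_combination -f * hc
  · rw [map_sub, rs_constant, map_sub, SheafDerivation.map_constant, sub_zero]
    change δ.app _ hle _ = 1
    rw [← δ.rs_app le_rfl hle, hδ, htd.apply_self, map_one]
  · rw [htd.sheafDerivation_eq hU δ hδ hle ε hV, map_sub, rs_constant, map_sub, ε.map_constant,
      sub_zero]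
    rfl

namespace IsUniformizer

variable [LocallyOfFiniteType s] {P : C} {hP : IsClosed {P}} {U : C.Opens} {hPU : P ∈ U}
  {τ : Γ(C, U)} {δ : SheafDerivation s U}

lemma basicOpen_eq (h : IsUniformizer s hP hPU τ δ) :
    C.basicOpen τ = U ⊓ ⟨{P}ᶜ, hP.isOpen_compl⟩ := by
  apply le_antisymm
  · refine le_inf (C.basicOpen_le τ) fun x hx hxP ↦ ?_
    obtain rfl : x = P := hxP
    exact (evalAt_eq_zero_iff s hP hPU τ).1 h.eval_eq_zero hx
  · intro x ⟨hxU, hxP⟩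
    obtain ⟨f, hf, hxf⟩ := h.isAffineOpen.exists_basicOpen_le
      (V := ⟨{P}ᶜ, hP.isOpen_compl⟩) ⟨x, hxP⟩ hxU
    obtain ⟨b, rfl⟩ := h.exists_eq_mul f
      ((evalAt_eq_zero_iff s hP hPU f).2 fun hPf ↦ hf hPf rfl)
    exact (C.basicOpen_mul τ b).le.trans inf_le_left hxf

variable [IsIntegral C]

/-- A function which vanishes at `P` is a multiple of the uniformizer in the local ring. -/
lemma exists_toK_eq_mul (h : IsUniformizer s hP hPU τ δ) {V : C.Opens} (hPV : P ∈ V) (a : Γ(C, V))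
    (ha : evalAt s hP hPV a = 0) :
    ∃ y ∈ localSubring P, toK V (nonempty_of_mem hPV) a = toK U (nonempty_of_mem hPU) τ * y := by
  obtain ⟨r, hrV, hPr⟩ := h.isAffineOpen.exists_basicOpen_le ⟨P, hPV⟩ hPU
  have hle := C.basicOpen_le r
  obtain ⟨n, b, hb⟩ := exists_pow_mul_eq_rs h.isAffineOpen r (rs hrV a)
  have hb0 : evalAt s hP hPU b = 0 := by
    rw [← evalAt_rs s hP hle hPr, ← hb, map_mul, evalAt_rs, ha, mul_zero]
  obtain ⟨e, rfl⟩ := h.exists_eq_mul b hb0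
  obtain ⟨c, hc⟩ := ((isUnit_rs_basicOpen r).pow n).exists_right_inv
  have hner : (C.basicOpen r : Set C).Nonempty := ⟨P, hPr⟩
  refine ⟨toK _ hner (rs hle e * c), toK_mem hPr _, ?_⟩
  rw [← toK_rs hrV hner, ← toK_rs hle hner, ← map_mul]
  congr 1
  rw [map_mul] at hb
  linear_combination -rs hrV a * hc + c * hb

lemma inv_notMem (h : IsUniformizer s hP hPU τ δ) :
    (toK U (nonempty_of_mem hPU) τ)⁻¹ ∉ localSubring P := by
  intro hmem
  obtain ⟨V, hPV, a, ha⟩ := exists_toK_eq hmem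
  have hτ : toK U (nonempty_of_mem hPU) τ ≠ 0 := by
    intro h0
    have h1 := h.apply_self
    rw [toK_injective _ _ (h0.trans (map_zero _).symm), map_zero] at h1
    exact zero_ne_one ((map_zero (evalAt s hP hPU)).symm.trans (congr(evalAt s hP hPU $h1).trans
      (map_one _)))
  have hPUV : P ∈ U ⊓ V := ⟨hPU, hPV⟩
  have h1 : rs (inf_le_left : U ⊓ V ≤ U) τ * rs inf_le_right a = 1 := by
    apply toK_injective _ (nonempty_of_mem hPUV)
    rw [map_mul, toK_rs, toK_rs, ha, map_one, mul_inv_cancel₀ hτ]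
  have h2 := congr(evalAt s hP hPUV $h1)
  rw [map_mul, evalAt_rs, h.eval_eq_zero, zero_mul, map_one] at h2
  exact zero_ne_one h2

end IsUniformizer

/-- The local rings of a complete smooth curve, with a choice of uniformizers. -/
lemma exists_curveField [CharZero k] [IsIntegral C] [IsProper s]
    (h : ∀ x : C, ∃ U : C.Opens, x ∈ U ∧ IsAffineOpen U ∧ ∃ (t : Γ(C, U)) (d : _), IsCoord s t d) :
    letI := ((toK ⊤ Set.univ_nonempty).comp (constant s ⊤)).toAlgebra
    ∃ F : CurveField k C.functionField {P : C // IsClosed {P}},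
      (∀ P x, x ∈ F.O P ↔ x ∈ localSubring P.1) ∧
      ∀ P, ∃ (U : C.Opens) (hPU : P.1 ∈ U) (τ : Γ(C, U)) (δ : SheafDerivation s U),
        IsUniformizer s P.2 hPU τ δ ∧ F.τ P = toK U (nonempty_of_mem hPU) τ := by
  let alg := ((toK (C := C) ⊤ Set.univ_nonempty).comp (constant s ⊤)).toAlgebra
  have halg {V : C.Opens} (hV : (V : Set C).Nonempty) (c : k) :
      algebraMap k C.functionField c = toK V hV (constant s V c) := by
    rw [← rs_constant s le_top, toK_rs]; rfl
  have : CompactSpace C := compactSpace_of_universallyClosed s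
  choose U hPU τ δ hu using fun P : {P : C // IsClosed {P}} ↦ exists_isUniformizer h P.2
  refine ⟨{
    O := fun P ↦ { localSubring P.1 with
      algebraMap_mem' := fun c ↦ by
        rw [halg (nonempty_of_mem (hPU P))]
        exact toK_mem (hPU P) _ }
    τ := fun P ↦ toK (U P) (nonempty_of_mem (hPU P)) (τ P)
    τ_mem := fun P ↦ toK_mem (hPU P) _
    inv_τ_notMem := fun P ↦ (hu P).inv_notMem
    exists_const := fun P {x} hx ↦ ?_
    const := fun {x} hx ↦ ?_ }, fun P x ↦ Iff.rfl, fun P ↦ ⟨U P, hPU P, τ P, δ P, hu P, rfl⟩⟩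
  · obtain ⟨V, hPV, a, rfl⟩ := exists_toK_eq hx
    obtain ⟨y, hy, hay⟩ := (hu P).exists_toK_eq_mul hPV (a - constant s V (evalAt s P.2 hPV a))
      (by simp)
    refine ⟨evalAt s P.2 hPV a, y, hy, ?_⟩
    rw [← hay, map_sub, ← halg]
    ring
  · obtain ⟨a, rfl⟩ := exists_toK_eq_of_forall_mem (V := ⊤) Set.univ_nonempty (f := x)
      fun y _ ↦ by
        obtain ⟨z, hz, hyz⟩ := exists_isClosed_specializes y
        exact localSubring_mono hyz (hx ⟨z, hz⟩)
    obtain ⟨c, rfl⟩ := exists_constant_eq s a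
    exact ⟨c, (halg _ _).symm⟩

/-- On a curve with `H¹(C, 𝒪) = 0`, every closed point is the only pole, of order one, of a
function. -/
lemma IsUniformizer.exists_pole [IsIntegral C] [LocallyOfFiniteType s] {P : C} {hP : IsClosed {P}}
    {U : C.Opens} {hPU : P ∈ U} {τ : Γ(C, U)} {δ : SheafDerivation s U}
    (h : IsUniformizer s hP hPU τ δ)
    (hMV : SplitsOnPairs C) :
    ∃ (c : Γ(C, ⟨{P}ᶜ, hP.isOpen_compl⟩)) (w : Γ(C, U)),
      rs inf_le_left τ * rs inf_le_right c = rs (inf_le_left : U ⊓ _ ≤ U) w ∧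
      ∀ hne, toK _ hne c ∉ localSubring P := by
  have hτ : IsUnit (rs (inf_le_left : U ⊓ ⟨{P}ᶜ, hP.isOpen_compl⟩ ≤ U) τ) :=
    isUnit_rs _ _ h.basicOpen_eq.ge
  obtain ⟨a, ha⟩ := hτ.exists_right_inv
  obtain ⟨b, c, hbc⟩ := hMV U ⟨{P}ᶜ, hP.isOpen_compl⟩ (by
    refine top_le_iff.1 fun x _ ↦ ?_
    by_cases hx : x = P
    · exact Or.inl (hx ▸ hPU)
    · exact Or.inr hx) a
  have hτc : rs inf_le_left τ * rs inf_le_right c =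
      rs (inf_le_left : U ⊓ ⟨{P}ᶜ, hP.isOpen_compl⟩ ≤ U) (τ * b - 1) := by
    rw [map_sub, map_one, map_mul, ← ha, ← hbc]; ring
  refine ⟨c, τ * b - 1, hτc, fun hne hmem ↦ h.inv_notMem ?_⟩
  have hne' : ((U ⊓ ⟨{P}ᶜ, hP.isOpen_compl⟩ : C.Opens) : Set C).Nonempty := by
    obtain ⟨y, hy⟩ := hne
    obtain ⟨z, hzU, hz⟩ := (PreirreducibleSpace.isPreirreducible_univ (X := C)) U
      ({P}ᶜ : Set C) U.2 hP.isOpen_compl ⟨P, trivial, hPU⟩ ⟨y, trivial, hy⟩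
    exact ⟨z, hz⟩
  have h1 := congr(toK _ hne' $hτc)
  rw [map_mul, toK_rs, toK_rs, toK_rs, map_sub, map_one, map_mul] at h1
  have h2 : toK U (nonempty_of_mem hPU) τ ≠ 0 := by
    intro h0
    rw [h0] at h1
    simp at h1
  have h3 : (toK U (nonempty_of_mem hPU) τ)⁻¹ = toK U (nonempty_of_mem hPU) b - toK _ hne c := by
    field_simp
    linear_combination h1
  rw [h3]
  exact sub_mem (toK_mem hPU b) hmem

/-- On a complete smooth curve with `H¹(C, 𝒪) = 0`, a vector field which vanishes at three points
is zero. -/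
theorem SheafDerivation.app_eq_zero_of_vanishesAt [CharZero k] [IsProper s] [ConnectedSpace C]
    (h : ∀ x : C, ∃ U : C.Opens, x ∈ U ∧ IsAffineOpen U ∧ ∃ (t : Γ(C, U)) (d : _), IsCoord s t d)
    (hMV : SplitsOnPairs C)
    (v : SheafDerivation s ⊤) {P Q R : C} (hP : IsClosed {P}) (hQ : IsClosed {Q})
    (hR : IsClosed {R}) (hPQ : P ≠ Q) (hPR : P ≠ R) (hQR : Q ≠ R) (hvP : v.VanishesAt hP)
    (hvQ : v.VanishesAt hQ) (hvR : v.VanishesAt hR) {V : C.Opens} (a : Γ(C, V)) :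
    v.app V le_top a = 0 := by
  have := isIntegral_of_isCoord s h
  let := ((toK (C := C) ⊤ Set.univ_nonempty).comp (constant s ⊤)).toAlgebra
  obtain ⟨F, hF, hu⟩ := exists_curveField h
  -- a function with a simple pole, and the rational function it defines
  have hpole (P : {P : C // IsClosed {P}}) {Q : C} (hQ : P.1 ≠ Q) :
      ∃ (U : C.Opens) (hPU : P.1 ∈ U) (τ : Γ(C, U)) (δ : SheafDerivation s U)
        (c : Γ(C, ⟨{P.1}ᶜ, P.2.isOpen_compl⟩)) (w : Γ(C, U)) (hne : _),
        IsUniformizer s P.2 hPU τ δ ∧ F.τ P = toK U (nonempty_of_mem hPU) τ ∧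
        rs inf_le_left τ * rs inf_le_right c = rs (inf_le_left : U ⊓ _ ≤ U) w ∧
        F.PoleLE P (toK _ hne c) ∧ toK _ hne c ∉ F.O P ∧
        ((U ⊓ ⟨{P.1}ᶜ, P.2.isOpen_compl⟩ : C.Opens) : Set C).Nonempty := by
    obtain ⟨U, hPU, τ, δ, hτ, hFτ⟩ := hu P
    obtain ⟨c, w, hw, hc⟩ := hτ.exists_pole hMV
    have hne : ((⟨{P.1}ᶜ, P.2.isOpen_compl⟩ : C.Opens) : Set C).Nonempty := ⟨Q, hQ.symm⟩
    have hne' : ((U ⊓ ⟨{P.1}ᶜ, P.2.isOpen_compl⟩ : C.Opens) : Set C).Nonempty := by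
      obtain ⟨z, hzU, hz⟩ := (PreirreducibleSpace.isPreirreducible_univ (X := C)) U
        ({P.1}ᶜ : Set C) U.2 P.2.isOpen_compl ⟨P.1, trivial, hPU⟩ ⟨Q, trivial, hQ.symm⟩
      exact ⟨z, hz⟩
    refine ⟨U, hPU, τ, δ, c, w, hne, hτ, hFτ, hw, ⟨?_, fun {Q} hQ ↦ ?_⟩, ?_, hne'⟩
    · have h1 := congr(toK _ hne' $hw)
      rw [map_mul, toK_rs, toK_rs, toK_rs] at h1
      rw [hF, hFτ, h1]
      exact toK_mem hPU w
    · rw [hF]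
      exact toK_mem (U := ⟨{P.1}ᶜ, P.2.isOpen_compl⟩) (fun h ↦ hQ (Subtype.ext h)) c
    · rw [hF]
      exact hc hne
  obtain ⟨U, hPU, τ, δ, c, w, hne, hτ, hFτ, hw, hf, hfP, hne'⟩ := hpole ⟨P, hP⟩ hPQ
  obtain ⟨_, _, _, _, c', _, hne'', _, _, _, hg, hgQ, _⟩ := hpole ⟨Q, hQ⟩ hPQ.symm
  -- the derivative of the function with a pole at `P`
  obtain ⟨e, he⟩ := hτ.exists_eq_mul _ (hvP U hPU τ)
  have hvU {V : C.Opens} (hV : V ≤ U) (a : Γ(C, V)) :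
      v.app V le_top a = rs hV (τ * e) * δ.app V hV a := by
    rw [← he]
    exact hτ.derivation_eq (v.restrict le_top) hV a
  have hvc : toK _ hne (v.app _ le_top c) = toK U (nonempty_of_mem hPU) e *
      (toK U (nonempty_of_mem hPU) (δ.app U le_rfl w) - toK _ hne c) := by
    have h1 := congr(v.app _ le_top $hw)
    have hτ0 : toK U (nonempty_of_mem hPU) τ ≠ 0 := hFτ ▸ CurveField.τ_ne_zero _
    rw [v.leibniz, ← v.rs_app le_top, ← v.rs_app le_top, he, ← v.rs_app le_top, hvU le_rfl w,
      rs_refl] at h1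
    have h2 := congr(toK _ hne' $h1)
    simp only [map_add, map_mul, toK_rs] at h2
    refine mul_left_cancel₀ hτ0 ?_
    linear_combination h2
  have hx : toK _ hne (v.app _ le_top c) = 0 := by
    have hvan {Q : C} (hQ : IsClosed {Q}) (hPQ : P ≠ Q) (hv : v.VanishesAt hQ) :
        F.Vanishes ⟨Q, hQ⟩ (toK _ hne (v.app _ le_top c)) := by
      obtain ⟨U', hQU', τ', δ', hτ', hFτ'⟩ := hu ⟨Q, hQ⟩
      have hQ' : Q ∈ (⟨{P}ᶜ, hP.isOpen_compl⟩ : C.Opens) := hPQ.symm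
      obtain ⟨y, hy, h⟩ := hτ'.exists_toK_eq_mul hQ' (v.app _ le_top c) (hv _ hQ' c)
      exact ⟨y, (hF _ _).2 hy, by rw [hFτ', ← h]⟩
    refine CurveField.PoleLE.eq_zero_of_vanishes hf hfP hg hgQ (R := ⟨R, hR⟩)
      (fun h ↦ hPQ (congr_arg Subtype.val h).symm) (fun h ↦ hQR (congr_arg Subtype.val h).symm)
      ⟨?_, fun {S} hS ↦ ?_⟩ (hvan hQ hPQ hvQ) (hvan hR hPR hvR)
    · rw [hvc, mul_left_comm, mul_sub]
      refine mul_mem ((hF _ _).2 (toK_mem hPU e)) (sub_mem (mul_mem (F.τ_mem _) ?_) hf.τ_mul_mem)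
      exact (hF _ _).2 (toK_mem hPU _)
    · exact (hF _ _).2 (toK_mem (U := ⟨{P}ᶜ, hP.isOpen_compl⟩) (fun h ↦ hS (Subtype.ext h)) _)
  have he0 : e = 0 := by
    rw [hvc, mul_eq_zero] at hx
    rcases hx with hx | hx
    · exact toK_injective U (nonempty_of_mem hPU) (hx.trans (map_zero _).symm)
    · refine absurd ?_ hfP
      rw [← sub_eq_zero.1 hx]
      exact (hF _ _).2 (toK_mem hPU _)
  rcases Set.eq_empty_or_nonempty (V : Set C) with h0 | hV
  · exact eq_of_locally_eq fun z hz ↦ absurd (show z ∈ (∅ : Set C) from h0 ▸ hz) (by simp)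
  have hUV : ((U ⊓ V : C.Opens) : Set C).Nonempty := by
    obtain ⟨y, hy⟩ := hV
    obtain ⟨z, hzU, hz⟩ := (PreirreducibleSpace.isPreirreducible_univ (X := C)) U V U.2 V.2
      ⟨P, trivial, hPU⟩ ⟨y, trivial, hy⟩
    exact ⟨z, hz⟩
  apply toK_injective _ hV
  rw [← toK_rs inf_le_right hUV, v.rs_app le_top, hvU inf_le_left, he0]
  simp

end GenusZero

open SuperScheme

/-! ### Functions on a smooth superscheme of dimension `(1|1)` -/

namespace SuperScheme

variable {k : Type u} [Field k] {X : SuperScheme k} {U : X.even.Opens}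

/-- A superderivation `𝒪(U) → M` into a left module factors through the universal one. -/
lemma Kaehler.exists_lift {M : Type*} [AddCommGroup M] [Module (Fun X U) M] (D : Fun X U → M)
    (hadd : ∀ a b, D (a + b) = D a + D b) (hconst : ∀ c, D (.ofEven (Fun.const X U c)) = 0)
    (hmul : ∀ a b, D (a * b) = a • D b + (Fun.ofEven b.ev • D a + Fun.ofOdd b.od • D a.parity)) :
    ∃ f : X.Kaehler U →ₗ[Fun X U] M, ∀ a, f (Fun.d a) = D a := by
  refine ⟨Submodule.liftQ _ (Finsupp.linearCombination (Fun X U) D) (Submodule.span_le.2 ?_),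
    fun a ↦ ?_⟩
  · rintro r ((⟨a, b, rfl⟩ | ⟨c, rfl⟩) | ⟨a, b, rfl⟩) <;>
      simp [hadd, hconst, hmul, add_assoc]
  · change Finsupp.linearCombination (Fun X U) D _ = _
    simp

namespace Fun

lemma d_add (a b : Fun X U) : (a + b).d = a.d + b.d := by
  refine (Submodule.Quotient.eq _).2 ?_
  exact Submodule.subset_span (Or.inl (Or.inl ⟨a, b, rfl⟩))

lemma d_const (c : k) : (ofEven (const X U c)).d = 0 :=
  (Submodule.Quotient.mk_eq_zero _).2 (Submodule.subset_span (Or.inl (Or.inr ⟨c, rfl⟩)))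

lemma d_mul (a b : Fun X U) :
    (a * b).d = a • b.d + ofEven b.ev • a.d + ofOdd b.od • a.parity.d := by
  have h := (Submodule.Quotient.eq (Submodule.span (Fun X U) (X.kaehlerRel U))).2
    (Submodule.subset_span (Or.inr ⟨a, b, rfl⟩))
  refine h.trans ?_
  simp only [Fun.d, ← Submodule.Quotient.mk_smul, ← Submodule.Quotient.mk_add,
    Finsupp.smul_single, smul_eq_mul, mul_one]

@[simp] lemma d_zero : (0 : Fun X U).d = 0 := by
  simpa using d_const (X := X) (U := U) 0

/-- Reduction modulo the ideal generated by the odd functions. -/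
def toBos : Fun X U →+* Γ(X.even, U) ⧸ X.oddSq U where
  toFun a := Ideal.Quotient.mk _ a.ev
  map_one' := by simp
  map_mul' a b := by
    have : Ideal.Quotient.mk (X.oddSq U) (X.mul U a.od b.od) = 0 :=
      Ideal.Quotient.eq_zero_iff_mem.2 (Ideal.subset_span ⟨_, _, rfl⟩)
    simp [this]
  map_zero' := by simp
  map_add' a b := by simp

end Fun

lemma oddSq_le_jacobson : X.oddSq U ≤ Ideal.jacobson ⊥ := by
  refine Ideal.span_le.2 ?_
  rintro _ ⟨m, n, rfl⟩
  refine Ideal.mem_jacobson_bot.2 fun y ↦ IsNilpotent.isUnit_add_one ⟨2, ?_⟩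
  have h : X.mul U m n • m = 0 := by
    rw [mul_smul_assoc, mul_smul_assoc, mul_self, zero_smul]
  rw [mul_pow, pow_two (X.mul U m n), ← smul_eq_mul (X.mul U m n), ← LinearMap.smul_apply,
    ← map_smul, h, map_zero, LinearMap.zero_apply, zero_mul]

namespace IsCoordinates

variable {t : Γ(X.even, U)} {θ : Γ(X.odd, U)}

/-- The odd functions are generated by the odd coordinate: modulo `(𝒪⁻)³` because `a ↦ a⁻` is a
derivation into `𝒪⁻/(𝒪⁻)³` which kills `t`, hence outright by Nakayama's lemma. -/
lemma exists_eq_smul (h : IsCoordinates t θ) (hfin : Module.Finite Γ(X.even, U) Γ(X.odd, U))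
    (m : Γ(X.odd, U)) : ∃ a : Γ(X.even, U), m = a • θ := by
  let I := X.oddSq U
  let N := Γ(X.odd, U) ⧸ (I • ⊤ : Submodule Γ(X.even, U) Γ(X.odd, U))
  let : Module (Fun X U) N := Module.compHom N (Fun.toBos (X := X) (U := U))
  have hsmul (a : Fun X U) (n : Γ(X.odd, U)) :
      a • (Submodule.Quotient.mk n : N) = Submodule.Quotient.mk (a.ev • n) := rfl
  obtain ⟨f, hf⟩ := Kaehler.exists_lift (M := N) (fun a ↦ Submodule.Quotient.mk a.od)
    (fun a b ↦ by simp) (fun c ↦ by simp) (fun a b ↦ by simp [hsmul])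
  have hle : (⊤ : Submodule Γ(X.even, U) Γ(X.odd, U)) ≤ Submodule.span _ {θ} ⊔ I • ⊤ := by
    intro n _
    obtain ⟨⟨p, q⟩, hpq⟩ := h.2 (Fun.ofOdd n).d
    have h1 := congr(f $hpq)
    simp only [map_add, map_smul, hf, hsmul] at h1
    simp only [Fun.od_ofEven, Fun.od_ofOdd, smul_zero] at h1
    replace h1 := (Submodule.Quotient.eq _).1
      (((Submodule.Quotient.mk_add (I • ⊤ : Submodule Γ(X.even, U) Γ(X.odd, U))).trans h1).symm)
    rw [zero_add] at h1
    rw [← add_sub_cancel (q.ev • θ) n]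
    exact Submodule.add_mem_sup (Submodule.smul_mem _ _ (Submodule.mem_span_singleton_self θ)) h1
  have := Submodule.le_of_le_smul_of_le_jacobson_bot hfin.fg_top oddSq_le_jacobson hle
  obtain ⟨a, ha⟩ := Submodule.mem_span_singleton.1 (this (Submodule.mem_top (x := m)))
  exact ⟨a, ha.symm⟩

lemma mul_eq_zero (h : IsCoordinates t θ) (hfin : Module.Finite Γ(X.even, U) Γ(X.odd, U))
    (m n : Γ(X.odd, U)) : X.mul U m n = 0 := by
  obtain ⟨a, rfl⟩ := h.exists_eq_smul hfin m
  obtain ⟨b, rfl⟩ := h.exists_eq_smul hfin n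
  simp [X.mul_self]

lemma eq_zero_of_smul_eq_zero (h : IsCoordinates t θ)
    (hfin : Module.Finite Γ(X.even, U) Γ(X.odd, U)) {a : Γ(X.even, U)} (ha : a • θ = 0) :
    a = 0 := by
  obtain ⟨⟨p, q⟩, hpq⟩ := h.2 (Fun.ofEven a).d
  have h0 : Fun.ofEven a * Fun.ofOdd θ = 0 := by ext <;> simp [ha]
  have h1 := Fun.d_mul (Fun.ofEven a) (Fun.ofOdd θ)
  have hpar : (Fun.ofEven a).parity = Fun.ofEven a := by ext <;> simp
  rw [h0, Fun.d_zero, hpar, ← hpq] at h1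
  have h2 : (Fun.ofOdd θ * p) • (Fun.ofEven t).d + (Fun.ofEven a + Fun.ofOdd θ * q) •
      (Fun.ofOdd θ).d = (0 : Fun X U) • (Fun.ofEven t).d + (0 : Fun X U) • (Fun.ofOdd θ).d := by
    rw [zero_smul, zero_smul, add_zero, h1]
    simp only [Fun.ev_ofOdd, Fun.od_ofOdd, map_zero, zero_smul, smul_add, add_smul, mul_smul]
    abel
  have h3 := congr((Prod.snd $(h.1 (a₁ := (Fun.ofOdd θ * p, Fun.ofEven a + Fun.ofOdd θ * q))
    (a₂ := (0, 0)) h2)).ev)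
  simpa [h.mul_eq_zero hfin] using h3

lemma exists_isCoord (h : IsCoordinates t θ) (hfin : Module.Finite Γ(X.even, U) Γ(X.odd, U)) :
    ∃ d, IsCoord X.toSpec t d := by
  let := (constant X.toSpec U).toAlgebra
  have hc (c : k) : Fun.const X U c = algebraMap k Γ(X.even, U) c := rfl
  choose p hp using fun a : Γ(X.even, U) ↦ h.2 (Fun.ofEven a).d
  have hpar (a : Γ(X.even, U)) : (Fun.ofEven a).parity = Fun.ofEven a := by ext <;> simp
  have hadd (a b) : p (a + b) = p a + p b := h.1 <| by
    simp only [hp, Prod.fst_add, Prod.snd_add, add_smul]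
    rw [map_add, Fun.d_add, ← hp a, ← hp b]; exact add_add_add_comm _ _ _ _
  have hconst (c : k) : p (algebraMap k _ c) = 0 := h.1 <| by
    simp only [hp, ← hc, Fun.d_const, Prod.fst_zero, Prod.snd_zero, zero_smul, add_zero]
  have hmul (a b) : p (a * b) = Fun.ofEven a • p b + Fun.ofEven b • p a := h.1 <| by
    have : Fun.ofEven (a * b) = Fun.ofEven a * Fun.ofEven b := by ext <;> simp
    simp only [hp, Prod.fst_add, Prod.snd_add, Prod.smul_fst, Prod.smul_snd, add_smul, smul_assoc]
    rw [this, Fun.d_mul, ← hp a, ← hp b, hpar]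
    simp only [Fun.ev_ofEven, Fun.od_ofEven, map_zero, zero_smul, smul_add]
    abel
  have ht : p t = (1, 0) := h.1 <| by simp [hp]
  let δ : Derivation k Γ(X.even, U) Γ(X.even, U) := Derivation.mk'
    { toFun := fun a ↦ (p a).1.ev
      map_add' := fun a b ↦ by simp [hadd]
      map_smul' := fun c a ↦ by simp [Algebra.smul_def, hmul, hconst] }
    fun a b ↦ by
      change (p (a * b)).1.ev = a * (p b).1.ev + b * (p a).1.ev
      simp [hmul]
  refine ⟨δ, δ, fun _ ↦ rfl, ?_, fun a ↦ ?_⟩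
  · change (p t).1.ev = 1
    simp [ht]
  -- the universal derivation of `𝒪⁺` extends by zero to a superderivation
  let ev : Fun X U →+* Γ(X.even, U) :=
    { Fun.ev with
      map_one' := rfl
      map_mul' := fun a b ↦ by
        change (a * b).ev = a.ev * b.ev
        simp [h.mul_eq_zero hfin] }
  let Ω := KaehlerDifferential k Γ(X.even, U)
  let : Module (Fun X U) Ω := Module.compHom Ω ev
  have hsmul (a : Fun X U) (ω : Ω) : a • ω = a.ev • ω := rfl
  obtain ⟨f, hf⟩ := Kaehler.exists_lift (X := X) (U := U) (M := Ω)
    (fun a ↦ KaehlerDifferential.D k _ a.ev)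
    (fun a b ↦ by simp) (fun c ↦ by simp [hc])
    (fun a b ↦ by simp [hsmul, h.mul_eq_zero hfin])
  have h1 := congr(f $(hp a))
  simp only [map_add, map_smul, hf, hsmul] at h1
  simp only [Fun.ev_ofEven, Fun.ev_ofOdd, map_zero, smul_zero, add_zero] at h1
  exact h1.symm

end IsCoordinates
end SuperScheme

/-! ### Supercurves are split locally -/

lemma splitsOnPairs_of_subsingleton_H1 {C : Scheme.{u}}
    [HasExt.{u} (Sheaf (Opens.grothendieckTopology C) AddCommGrpCat.{u})]
    (h : Subsingleton (C.abSheaf.H' 1 (⊤ : Opens C))) : SplitsOnPairs C :=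
  fun _ _ hUV a ↦ exists_sub_eq_of_subsingleton_H1 C.abSheaf h hUV a

lemma SplitsOnPairs.of_isIso {C D : Scheme.{u}} (f : C ⟶ D) [IsIso f] (h : SplitsOnPairs C) :
    SplitsOnPairs D := by
  intro U V hUV a
  obtain ⟨b, c, hbc⟩ := h (f ⁻¹ᵁ U) (f ⁻¹ᵁ V) (by rw [← Scheme.Hom.preimage_sup, hUV]; rfl)
    (f.app (U ⊓ V) a)
  have hbij (W : D.Opens) : Function.Bijective (f.app W) :=
    ConcreteCategory.bijective_of_isIso (f.app W)
  obtain ⟨b, rfl⟩ := (hbij U).2 b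
  obtain ⟨c, rfl⟩ := (hbij V).2 c
  refine ⟨b, c, (hbij _).1 ?_⟩
  rw [← hbc, map_sub]
  congr 1
  · exact congr($(f.naturality (homOfLE (inf_le_left : U ⊓ V ≤ U)).op) b)
  · exact congr($(f.naturality (homOfLE (inf_le_right : U ⊓ V ≤ V)).op) c)

namespace SuperScheme

variable {k : Type u} [Field k] {X : SuperScheme k}

/-- Restriction of odd functions. -/
def ro {U V : X.even.Opens} (h : V ≤ U) : Γ(X.odd, U) →+ Γ(X.odd, V) :=
  (X.odd.presheaf.map (homOfLE h).op).hom

lemma ro_ro {U V W : X.even.Opens} (h : V ≤ U) (h' : W ≤ V) (m : Γ(X.odd, U)) :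
    ro h' (ro h m) = ro (h'.trans h) m := by
  simp only [ro, ← ConcreteCategory.comp_apply, ← Functor.map_comp]
  rfl

lemma ro_refl {U : X.even.Opens} (m : Γ(X.odd, U)) : ro le_rfl m = m := by simp [ro]

lemma ro_smul {U V : X.even.Opens} (h : V ≤ U) (a : Γ(X.even, U)) (m : Γ(X.odd, U)) :
    ro h (a • m) = rs h a • ro h m := Scheme.Modules.map_smul _ _ _ _

lemma odd_eq_of_locally_eq {U : X.even.Opens} {m n : Γ(X.odd, U)}
    (h : ∀ x ∈ U, ∃ (V : X.even.Opens) (hV : V ≤ U), x ∈ V ∧ ro hV m = ro hV n) : m = n := by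
  choose V hV hxV hmn using fun x : U ↦ h x.1 x.2
  exact TopCat.Sheaf.eq_of_locally_eq' ⟨X.odd.presheaf, X.odd.isSheaf⟩ V U
    (fun x ↦ homOfLE (hV x)) (fun x hx ↦ Opens.mem_iSup.2 ⟨⟨x, hx⟩, hxV _⟩) m n hmn

/-- Over every open subset of a coordinate chart, the odd functions are the multiples of the odd
coordinate by unique even functions. -/
lemma IsCoordinates.smul_bijective {U : X.even.Opens} {t : Γ(X.even, U)} {θ : Γ(X.odd, U)}
    (h : IsCoordinates t θ) (hU : IsAffineOpen U)
    (hfin : Module.Finite Γ(X.even, U) Γ(X.odd, U)) {V : X.even.Opens} (hV : V ≤ U) :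
    Function.Bijective fun a : Γ(X.even, V) ↦ a • ro hV θ := by
  have := X.isQuasicoherent
  have hinj {V : X.even.Opens} (hV : V ≤ U) {a : Γ(X.even, V)} (ha : a • ro hV θ = 0) :
      a = 0 := by
    refine eq_of_locally_eq fun x hx ↦ ?_
    obtain ⟨r, hrV, hxr⟩ := hU.exists_basicOpen_le ⟨x, hx⟩ (hV hx)
    have hle := X.even.basicOpen_le r
    refine ⟨_, hrV, hxr, ?_⟩
    obtain ⟨n, b, hb⟩ := exists_pow_mul_eq_rs hU r (rs hrV a)
    have h1 : ro hle (b • θ) = 0 := by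
      rw [ro_smul, ← hb, mul_smul, ← ro_ro hV hrV, ← ro_smul, ha, map_zero, smul_zero]
    obtain ⟨m, hm⟩ := (exists_pow_smul_eq X.odd hU r).2 _ h1
    rw [← mul_smul] at hm
    have h2 := congr(rs hle $(h.eq_zero_of_smul_eq_zero hfin hm))
    rw [_root_.map_mul, map_zero, map_pow] at h2
    have hu := isUnit_rs_basicOpen r
    have h3 := (hu.pow m).mul_right_eq_zero.1 h2
    rw [← hb] at h3
    rw [map_zero]
    exact (hu.pow n).mul_right_eq_zero.1 h3
  have hinj' {V : X.even.Opens} (hV : V ≤ U) {a b : Γ(X.even, V)}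
      (hab : a • ro hV θ = b • ro hV θ) : a = b :=
    sub_eq_zero.1 (hinj hV (by rw [sub_smul, hab, sub_self]))
  refine ⟨fun a b hab ↦ hinj' hV hab, fun m ↦ ?_⟩
  have hloc (x : V) : ∃ (r : Γ(X.even, U)) (hrV : X.even.basicOpen r ≤ V)
      (_ : x.1 ∈ X.even.basicOpen r)
      (a : Γ(X.even, X.even.basicOpen r)), a • ro (hrV.trans hV) θ = ro hrV m := by
    obtain ⟨r, hrV, hxr⟩ := hU.exists_basicOpen_le x (hV x.2)
    have hle := X.even.basicOpen_le r
    obtain ⟨n, m', hm'⟩ := (exists_pow_smul_eq X.odd hU r).1 (ro hrV m)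
    obtain ⟨b, rfl⟩ := h.exists_eq_smul hfin m'
    obtain ⟨c, hc⟩ := ((isUnit_rs_basicOpen r).pow n).exists_left_inv
    refine ⟨r, hrV, hxr, c * rs hle b, ?_⟩
    rw [mul_smul, ← ro_smul]
    change c • X.odd.presheaf.map (homOfLE hle).op (b • θ) = _
    rw [hm']
    change c • (rs hle r ^ n • ro hrV m) = _
    rw [← mul_smul, hc, one_smul]
  choose r hrV hxr a ha using hloc
  obtain ⟨g, hg⟩ := exists_glue (fun x : V ↦ X.even.basicOpen (r x)) hrV
    (fun x hx ↦ ⟨⟨x, hx⟩, hxr _⟩) a fun x y ↦ by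
      refine hinj' (inf_le_left.trans ((hrV x).trans hV)) ?_
      rw [← ro_ro ((hrV x).trans hV) inf_le_left, ← ro_smul, ha, ro_ro,
        ro_ro ((hrV x).trans hV) inf_le_left, ← ro_ro ((hrV y).trans hV) inf_le_right, ← ro_smul,
        ha, ro_ro]
  refine ⟨g, odd_eq_of_locally_eq fun x hx ↦ ⟨_, hrV ⟨x, hx⟩, hxr _, ?_⟩⟩
  dsimp only
  rw [ro_smul, hg, ro_ro, ha]

namespace IsSupercurve

/-- A supercurve is locally split, so that the product of two odd functions is zero. -/
lemma mul_eq_zero (hX : X.IsSupercurve) {V : X.even.Opens} (m n : Γ(X.odd, V)) :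
    X.mul V m n = 0 := by
  refine eq_of_locally_eq fun x hx ↦ ?_
  obtain ⟨U, hxU, hU, t, θ, h⟩ := hX.smooth x
  have hfin := hX.coherent U hU
  refine ⟨U ⊓ V, inf_le_right, ⟨hxU, hx⟩, ?_⟩
  obtain ⟨a, ha⟩ := (h.smul_bijective hU hfin (inf_le_left : U ⊓ V ≤ U)).2 (ro inf_le_right m)
  obtain ⟨b, hb⟩ := (h.smul_bijective hU hfin (inf_le_left : U ⊓ V ≤ U)).2 (ro inf_le_right n)
  dsimp only at ha hb
  refine (X.map_mul inf_le_right m n).trans ?_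
  change X.mul _ (ro _ m) (ro _ n) = _
  rw [← ha, ← hb]
  simp [X.mul_self]

lemma oddSq_eq_bot (hX : X.IsSupercurve) (V : X.even.Opens) : X.oddSq V = ⊥ := by
  refine Ideal.span_eq_bot.2 ?_
  rintro _ ⟨m, n, rfl⟩
  exact hX.mul_eq_zero m n

/-- The bosonic reduction of a supercurve is `(X, 𝒪⁺)`. -/
lemma splitsOnPairs (hX : X.IsSupercurve) (hg : X.IsGenusZero) : SplitsOnPairs X.even := by
  let I : X.even.IdealSheafData := .ofIdeals fun U : X.even.affineOpens ↦ X.oddSq U.1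
  have hI : I = ⊥ := le_bot_iff.1 fun U ↦
    (Scheme.IdealSheafData.ideal_ofIdeals_le _ U).trans (hX.oddSq_eq_bot U.1).le
  have : IsIso I.subschemeι := (Scheme.isIso_subschemeι_iff_eq_bot I).2 hI
  let : HasExt.{u} (Sheaf (Opens.grothendieckTopology X.bos) AddCommGrpCat.{u}) :=
    hasExt_of_enoughInjectives _
  exact SplitsOnPairs.of_isIso I.subschemeι (splitsOnPairs_of_subsingleton_H1 hg)

end IsSupercurve
end SuperScheme

/-! ### Vector fields in coordinates -/

namespace SuperScheme

variable {k : Type u} [Field k] {X : SuperScheme k} {U : X.even.Opens}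

lemma Fun.ev_res_eq {V : X.even.Opens} (h : V ≤ U) (a : Fun X U) :
    (Fun.res h a).ev = rs h a.ev := Fun.ev_res h a

lemma Fun.od_res_eq {V : X.even.Opens} (h : V ≤ U) (a : Fun X U) :
    (Fun.res h a).od = ro h a.od := Fun.od_res h a

/-- Coordinates `(t | θ)` on an open set `U`, in the form in which they are used: every odd
function `m` on an open subset is `(coeff m) θ`, products of odd functions vanish, and `∂ = d/dt`
is a frame of the derivations of `𝒪⁺`. -/
structure Chart (X : SuperScheme k) (U : X.even.Opens) where
  t : Γ(X.even, U)
  θ : Γ(X.odd, U)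
  coeff (V : X.even.Opens) (h : V ≤ U) : Γ(X.odd, V) →ₗ[Γ(X.even, V)] Γ(X.even, V)
  deriv : SheafDerivation X.toSpec U
  mul_eq_zero {V : X.even.Opens} (h : V ≤ U) (m n : Γ(X.odd, V)) : X.mul V m n = 0
  coeff_smul {V : X.even.Opens} (h : V ≤ U) (m : Γ(X.odd, V)) : coeff V h m • ro h θ = m
  coeff_θ {V : X.even.Opens} (h : V ≤ U) : coeff V h (ro h θ) = 1
  deriv_t : deriv.app U le_rfl t = 1
  derivation_eq {W V : X.even.Opens} (hW : W ≤ U) (hV : V ≤ W) (ε : SheafDerivation X.toSpec W)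
    (a : Γ(X.even, V)) :
    ε.app V hV a = rs hV (ε.app W le_rfl (rs hW t)) * deriv.app V (hV.trans hW) a

namespace Chart

/-- Restriction of coordinates. -/
def restrict (ch : Chart X U) {V : X.even.Opens} (h : V ≤ U) : Chart X V where
  t := rs h ch.t
  θ := ro h ch.θ
  coeff W hW := ch.coeff W (hW.trans h)
  deriv := ch.deriv.restrict h
  mul_eq_zero hW := ch.mul_eq_zero (hW.trans h)
  coeff_smul hW m := by rw [ro_ro, ch.coeff_smul]
  coeff_θ hW := by rw [ro_ro, ch.coeff_θ]
  deriv_t := by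
    change ch.deriv.app V h _ = 1
    rw [← ch.deriv.rs_app le_rfl h, ch.deriv_t, map_one]
  derivation_eq hW hV ε a := by
    rw [rs_rs]
    exact ch.derivation_eq (hW.trans h) hV ε a

variable (ch : Chart X U)

lemma coeff_ro {V W : X.even.Opens} (h : V ≤ U) (hW : W ≤ V) (m : Γ(X.odd, V)) :
    rs hW (ch.coeff V h m) = ch.coeff W (hW.trans h) (ro hW m) := by
  conv_rhs => rw [← ch.coeff_smul h m, ro_smul, ro_ro, map_smul, ch.coeff_θ, smul_eq_mul, mul_one]

lemma coeff_smul_comm {V : X.even.Opens} (h : V ≤ U) (m n : Γ(X.odd, V)) :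
    ch.coeff V h m • n = ch.coeff V h n • m := by
  conv_lhs => rw [← ch.coeff_smul h n]
  conv_rhs => rw [← ch.coeff_smul h m]
  rw [smul_smul, smul_smul, mul_comm]

/-- The vector field `∂/∂θ`. -/
def dθ : VectorField X U where
  app V h := Fun.ofEven.comp ((ch.coeff V h).toAddMonoidHom.comp Fun.od)
  isSuperDerivation V h :=
    { const := fun c ↦ by simp
      even_mul := fun a b ↦ by ext <;> simp
      odd_mul := fun a b ↦ by
        ext
        · simp [mul_comm]
          exact add_comm _ _
        · simp [ch.coeff_smul_comm h a.od] }
  res_app hV hW a := by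
    ext
    · simpa [Fun.ev_res_eq, Fun.od_res_eq, -Fun.ev_res, -Fun.od_res] using ch.coeff_ro hV hW a.od
    · simp

/-- The action of `∂/∂t` on odd functions. -/
def derivOdd (V : X.even.Opens) (h : V ≤ U) : Γ(X.odd, V) →+ Γ(X.odd, V) :=
  AddMonoidHom.mk' (fun m ↦ ch.deriv.app V h (ch.coeff V h m) • ro h ch.θ)
    fun m n ↦ by rw [map_add, map_add, add_smul]

lemma derivOdd_smul {V : X.even.Opens} (h : V ≤ U) (a : Γ(X.even, V)) (m : Γ(X.odd, V)) :
    ch.derivOdd V h (a • m) = a • ch.derivOdd V h m + ch.deriv.app V h a • m := by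
  change ch.deriv.app V h (ch.coeff V h (a • m)) • ro h ch.θ =
    a • (ch.deriv.app V h (ch.coeff V h m) • ro h ch.θ) + _
  conv_rhs => rw [← ch.coeff_smul h m]
  rw [map_smul, smul_eq_mul, ch.deriv.leibniz, map_smul, ch.coeff_θ, smul_eq_mul, mul_one, add_smul,
    mul_smul, smul_smul (ch.deriv.app V h a), mul_comm (ch.coeff V h m)]

lemma ro_derivOdd {V W : X.even.Opens} (h : V ≤ U) (hW : W ≤ V) (m : Γ(X.odd, V)) :
    ro hW (ch.derivOdd V h m) = ch.derivOdd W (hW.trans h) (ro hW m) := by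
  change ro hW (ch.deriv.app V h (ch.coeff V h m) • ro h ch.θ) =
    ch.deriv.app W _ (ch.coeff W _ (ro hW m)) • ro _ ch.θ
  rw [ro_smul, ro_ro, ch.deriv.rs_app, coeff_ro]

/-- The vector field `∂/∂t`. -/
def dt : VectorField X U where
  app V h := Fun.ofEven.comp ((ch.deriv.app V h).comp Fun.ev) +
    Fun.ofOdd.comp ((ch.derivOdd V h).comp Fun.od)
  isSuperDerivation V h :=
    { const := fun c ↦ by
        have : ch.deriv.app V h (Fun.const X V c) = 0 := ch.deriv.map_constant h c
        ext <;> simp [this]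
      even_mul := fun a b ↦ by
        ext
        · simp only [map_add, ev_evenPart, Fun.ev_mul, ch.mul_eq_zero h, add_zero]
          simp only [AddMonoidHom.add_apply, AddMonoidHom.comp_apply, map_add,
            Fun.ev_ofEven, Fun.ev_ofOdd, ch.deriv.leibniz, add_zero]
          ring
        · simp only [ev_evenPart, od_evenPart, AddMonoidHom.add_apply, AddMonoidHom.comp_apply,
            Fun.od_ofEven, Fun.od_ofOdd, Fun.ev_ofEven, Fun.ev_ofOdd, Fun.od_mul, map_add,
            ch.derivOdd_smul, add_zero, zero_add, map_zero]
          abel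
      odd_mul := fun a b ↦ by ext <;> simp }
  res_app hV hW a := by
    ext
    · simpa [Fun.ev_res_eq, -Fun.ev_res] using ch.deriv.rs_app hV hW a.ev
    · simpa [Fun.od_res_eq, -Fun.od_res] using ch.ro_derivOdd hV hW a.od

end Chart

namespace VectorField

variable (Y : VectorField X U)

/-- The derivation of `𝒪⁺` induced by the even part of a vector field. -/
def evenDer : SheafDerivation X.toSpec U where
  app V h := Fun.ev.comp ((Y.app V h).comp Fun.ofEven)
  map_constant {V} h c := by
    have := (Y.isSuperDerivation V h).const c
    exact congr(Fun.ev $this)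
  leibniz {V} h a b := by
    have := congr(($((Y.isSuperDerivation V h).even_mul (Fun.ofEven a) (Fun.ofEven b))).ev)
    rw [add_comm, mul_comm b]
    simpa using this
  rs_app {V W} hV hW a := by
    have := congr(($(Y.res_app hV hW (Fun.ofEven a))).ev)
    have h : Fun.res hW (Fun.ofEven a) = Fun.ofEven (rs hW a) := by ext <;> simp [rs]
    rw [h, Fun.ev_res] at this
    exact this

/-- The odd part of a vector field induces a derivation `𝒪⁺ → 𝒪⁻ ≅ 𝒪⁺`. -/
def coeffDer (ch : Chart X U) : SheafDerivation X.toSpec U where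
  app V h := (ch.coeff V h).toAddMonoidHom.comp (Fun.od.comp ((Y.app V h).comp Fun.ofEven))
  map_constant {V} h c := by
    have : Y.app V h (Fun.ofEven (constant X.toSpec V c)) = 0 := (Y.isSuperDerivation V h).const c
    simp [this]
  leibniz {V} h a b := by
    have := congr(ch.coeff V h
      ($((Y.isSuperDerivation V h).odd_mul (Fun.ofEven a) (Fun.ofEven b))).od)
    rw [add_comm]
    simpa using this
  rs_app {V W} hV hW a := by
    have := congr(($(Y.res_app hV hW (Fun.ofEven a))).od)
    have h : Fun.res hW (Fun.ofEven a) = Fun.ofEven (rs hW a) := by ext <;> simp [rs]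
    rw [h, Fun.od_res_eq] at this
    refine (ch.coeff_ro hV hW _).trans ?_
    exact congr(ch.coeff W _ $this)

/-- The square of the odd part of a vector field induces a derivation of `𝒪⁺`, if products of odd
functions vanish. -/
def oddSqDer (hmul : ∀ {V : X.even.Opens} (m n : Γ(X.odd, V)), X.mul V m n = 0) :
    SheafDerivation X.toSpec U where
  app V h := Fun.ev.comp ((Y.app V h).comp (Fun.ofOdd.comp
    (Fun.od.comp ((Y.app V h).comp Fun.ofEven))))
  map_constant {V} h c := by
    have : Y.app V h (Fun.ofEven (constant X.toSpec V c)) = 0 := (Y.isSuperDerivation V h).const c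
    simp [this]
  leibniz {V} h a b := by
    have h1 := congr(($((Y.isSuperDerivation V h).odd_mul (Fun.ofEven a) (Fun.ofEven b))).od)
    have h2 (a : Γ(X.even, V)) (m : Γ(X.odd, V)) :=
      congr(($((Y.isSuperDerivation V h).odd_mul (Fun.ofEven a) (Fun.ofOdd m))).ev)
    simp [hmul] at h1 h2
    rw [add_comm]
    simp [h1, h2]
  rs_app {V W} hV hW a := by
    have h1 := congr(($(Y.res_app hV hW (Fun.ofEven a))).od)
    have h2 (m : Γ(X.odd, V)) := congr(($(Y.res_app hV hW (Fun.ofOdd m))).ev)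
    have h3 : Fun.res hW (Fun.ofEven a) = Fun.ofEven (rs hW a) := by ext <;> simp [rs]
    have h4 (m : Γ(X.odd, V)) : Fun.res hW (Fun.ofOdd m) = Fun.ofOdd (ro hW m) := by
      ext <;> simp [ro]
    simp only [Fun.ev_res_eq, Fun.od_res_eq, h3, h4] at h1 h2
    exact (h2 _).trans congr((Y.app W _ (Fun.ofOdd $h1)).ev)

end VectorField

namespace Chart

variable (ch : Chart X U)

/-- The function `a + bθ`. -/
def fn (a b : Γ(X.even, U)) : Fun X U := Fun.ofEven a + Fun.ofOdd (b • ch.θ)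

@[simp] lemma ev_fn (a b : Γ(X.even, U)) : (ch.fn a b).ev = a := by simp [fn]

@[simp] lemma od_fn (a b : Γ(X.even, U)) : (ch.fn a b).od = b • ch.θ := by simp [fn]

lemma fn_injective {a b a' b' : Γ(X.even, U)} (h : ch.fn a b = ch.fn a' b') : a = a' ∧ b = b' := by
  have h1 := congr(($h).ev)
  have h2 := congr(ch.coeff U le_rfl ($h).od)
  have h3 := ch.coeff_θ le_rfl
  rw [ro_refl] at h3
  simpa [h3] using And.intro h1 h2

lemma exists_eq_fn (z : Fun X U) : ∃ a b, z = ch.fn a b := by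
  have h := ch.coeff_smul le_rfl z.od
  rw [ro_refl] at h
  refine ⟨z.ev, ch.coeff U le_rfl z.od, ?_⟩
  ext
  · simp
  · simp [h]

lemma fn_mul_fn (a b a' b' : Γ(X.even, U)) :
    ch.fn a b * ch.fn a' b' = ch.fn (a * a') (a * b' + a' * b) := by
  ext
  · simp [ch.mul_eq_zero le_rfl]
  · simp [add_smul, mul_smul]

lemma fn_add_fn (a b a' b' : Γ(X.even, U)) :
    ch.fn a b + ch.fn a' b' = ch.fn (a + a') (b + b') := by
  ext <;> simp [add_smul]

lemma fn_sub_fn (a b a' b' : Γ(X.even, U)) :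
    ch.fn a b - ch.fn a' b' = ch.fn (a - a') (b - b') := by
  ext <;> simp [sub_smul]

lemma fn_zero : ch.fn 0 0 = 0 := by ext <;> simp

/-- The expression of a vector field in coordinates. -/
lemma exists_coeffs (Y : VectorField X U) : ∃ α β γ η : Γ(X.even, U),
    (∀ a b, evenPart (Y.app U le_rfl) (ch.fn a b) =
      ch.fn (α * ch.deriv.app U le_rfl a) (α * ch.deriv.app U le_rfl b + β * b)) ∧
    ∀ a b, oddPart (Y.app U le_rfl) (ch.fn a b) = ch.fn (η * b) (γ * ch.deriv.app U le_rfl a) := by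
  have hco (m : Γ(X.odd, U)) : m = ch.coeff U le_rfl m • ch.θ := by
    conv_lhs => rw [← ch.coeff_smul le_rfl m, ro_refl]
  have hα (a : Γ(X.even, U)) : (Y.app U le_rfl (.ofEven a)).ev = _ :=
    ch.derivation_eq le_rfl le_rfl Y.evenDer a
  have hγ (a : Γ(X.even, U)) : ch.coeff U le_rfl (Y.app U le_rfl (.ofEven a)).od = _ :=
    ch.derivation_eq le_rfl le_rfl (Y.coeffDer ch) a
  rw [rs_refl, rs_refl] at hα hγ
  have hmul (b : Γ(X.even, U)) : Fun.ofEven b * Fun.ofOdd ch.θ = Fun.ofOdd (b • ch.θ) := by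
    ext <;> simp
  refine ⟨Y.evenDer.app U le_rfl ch.t, ch.coeff U le_rfl (Y.app U le_rfl (.ofOdd ch.θ)).od,
    (Y.coeffDer ch).app U le_rfl ch.t, (Y.app U le_rfl (.ofOdd ch.θ)).ev,
    fun a b ↦ ?_, fun a b ↦ ?_⟩
  · have h := congr(($((Y.isSuperDerivation U le_rfl).even_mul (.ofEven b) (.ofOdd ch.θ))).od)
    rw [hmul] at h
    simp at h
    ext
    · simp [hα]
    · rw [od_evenPart, od_fn, h, hα, od_fn, add_smul, mul_comm _ b, mul_smul b, ← hco, add_comm]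
  · have h := congr(($((Y.isSuperDerivation U le_rfl).odd_mul (.ofEven b) (.ofOdd ch.θ))).ev)
    rw [hmul] at h
    simp [ch.mul_eq_zero le_rfl] at h
    ext
    · simp [h, mul_comm]
    · rw [od_oddPart, ev_fn, od_fn, hco (Fun.od _), hγ]

/-- The derivations of `𝒪⁺` induced by a vector field, in coordinates. -/
lemma der_eq {W : X.even.Opens} {Y : VectorField X W} {hU : U ≤ W} {α β γ η : Γ(X.even, U)}
    (hY₀ : ∀ a b, evenPart (Y.app U hU) (ch.fn a b) =
      ch.fn (α * ch.deriv.app U le_rfl a) (α * ch.deriv.app U le_rfl b + β * b))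
    (hY₁ : ∀ a b, oddPart (Y.app U hU) (ch.fn a b) = ch.fn (η * b) (γ * ch.deriv.app U le_rfl a))
    (hmul : ∀ {V : X.even.Opens} (m n : Γ(X.odd, V)), X.mul V m n = 0) (a : Γ(X.even, U)) :
    Y.evenDer.app U hU a = α * ch.deriv.app U le_rfl a ∧
      (Y.oddSqDer hmul).app U hU a = η * (γ * ch.deriv.app U le_rfl a) := by
  have h₀ := congr(($(hY₀ a 0)).ev)
  have h₁ := congr(($(hY₁ a 0)).od)
  have h₂ (b) := congr(($(hY₁ 0 b)).ev)
  simp only [ev_evenPart, od_oddPart, ev_oddPart, ev_fn, od_fn] at h₀ h₁ h₂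
  refine ⟨h₀, ?_⟩
  change (Y.app U hU (Fun.ofOdd (Y.app U hU (Fun.ofEven a)).od)).ev = _
  rw [h₁, h₂]

end Chart

namespace IsSupercurve

lemma exists_isCoord (hX : X.IsSupercurve) (x : X.even) :
    ∃ U : X.even.Opens, x ∈ U ∧ IsAffineOpen U ∧
    ∃ (t : Γ(X.even, U)) (d : _), IsCoord X.toSpec t d := by
  obtain ⟨U, hxU, hU, t, θ, h⟩ := hX.smooth x
  exact ⟨U, hxU, hU, t, h.exists_isCoord (hX.coherent U hU)⟩

lemma isIntegral [IsAlgClosed k] [CharZero k] (hX : X.IsSupercurve) : IsIntegral X.even := by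
  have := hX.proper
  have := hX.connected
  exact isIntegral_of_isCoord X.toSpec hX.exists_isCoord

lemma exists_chart [IsAlgClosed k] [CharZero k] (hX : X.IsSupercurve) (x : X.even) :
    ∃ U : X.even.Opens, x ∈ U ∧ Nonempty (Chart X U) := by
  have := hX.isIntegral
  obtain ⟨U, hxU, hU, t, θ, h⟩ := hX.smooth x
  have hfin := hX.coherent U hU
  obtain ⟨d, hd⟩ := h.exists_isCoord hfin
  obtain ⟨δ, hδ⟩ := hd.exists_sheafDerivation hU
  let e (V : X.even.Opens) (hV : V ≤ U) : Γ(X.even, V) ≃ₗ[Γ(X.even, V)] Γ(X.odd, V) :=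
    .ofBijective (LinearMap.toSpanSingleton _ _ (ro hV θ)) (h.smul_bijective hU hfin hV)
  have he (V : X.even.Opens) (hV : V ≤ U) (a : Γ(X.even, V)) : e V hV a = a • ro hV θ := rfl
  exact ⟨U, hxU, ⟨{
    t := t
    θ := θ
    coeff := fun V hV ↦ (e V hV).symm.toLinearMap
    deriv := δ
    mul_eq_zero := fun _ ↦ hX.mul_eq_zero
    coeff_smul := fun {V} hV m ↦ (e V hV).apply_symm_apply m
    coeff_θ := fun {V} hV ↦ by
      change (e V hV).symm _ = 1
      rw [LinearEquiv.symm_apply_eq, he, one_smul]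
    deriv_t := by rw [hδ, hd.apply_self]
    derivation_eq := fun hW hV ε a ↦ hd.sheafDerivation_eq hU δ hδ hW ε hV a }⟩⟩

end IsSupercurve
end SuperScheme

/-! ### Superconformal vector fields in coordinates -/

namespace SuperRiemannSurface

variable {k : Type u} [Field k] {n : ℕ} (S : SuperRiemannSurface k n)

instance : IsProper S.X.toSpec := S.isSupercurve.proper

instance : ConnectedSpace S.X.even := S.isSupercurve.connected

lemma exists_eq_ev_of_unramified (i : Fin n) {V : S.X.even.Opens} (hi : S.puncture i ∈ V)
    (f : Γ(S.X.even, V)) (hf : S.puncture i ∉ S.X.even.basicOpen f) :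
    ∃ (W : S.X.even.Opens) (hW : W ≤ V), S.puncture i ∈ W ∧ ∃ a ∈ S.ideal W, rs hW f = a.ev := by
  obtain ⟨W, hW, hiW, a, ha, e, he, h⟩ := S.unramified i V hi f hf
  rw [S.isSupercurve.oddSq_eq_bot, Ideal.mem_bot] at he
  rw [he, add_zero] at h
  exact ⟨W, hW, hiW, a, ha, h⟩

variable [IsAlgClosed k] [CharZero k]

instance : IsIntegral S.X.even := S.isSupercurve.isIntegral

/-- A closed specialization `y` of a puncture is itself a puncture. Near `y` the divisor then has an
equation which is a uniformizer at `y`, invertible elsewhere, so no other puncture is nearby. -/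
lemma isClosed_puncture (i : Fin n) : IsClosed {S.puncture i} := by
  have : CompactSpace S.X.even := compactSpace_of_universallyClosed S.X.toSpec
  obtain ⟨y, hy, hxy⟩ := exists_isClosed_specializes (S.puncture i)
  suffices h : S.puncture i = y by rwa [h]
  obtain ⟨j, rfl⟩ := (S.mem_range_puncture_iff y).2 fun V hV a ha hya ↦
    (S.mem_range_puncture_iff _).1 ⟨i, rfl⟩ V (hxy.mem_open V.2 hV) a ha
      (hxy.mem_open (S.X.even.basicOpen a.ev).2 hya)
  by_contra hne
  obtain ⟨U, hU, τ, δ, hτ⟩ := exists_isUniformizer S.isSupercurve.exists_isCoord hy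
  obtain ⟨W, hW, hjW, a, ha, h⟩ := S.exists_eq_ev_of_unramified j hU τ
    ((evalAt_eq_zero_iff _ hy hU τ).1 hτ.eval_eq_zero)
  have hiW : S.puncture i ∈ W := hxy.mem_open W.2 hjW
  refine (S.mem_range_puncture_iff _).1 ⟨i, rfl⟩ W hiW a ha ?_
  rw [← h, basicOpen_rs, hτ.basicOpen_eq]
  exact ⟨hiW, hW hiW, hne⟩

/-- Coordinates on `U` together with the coefficients of a generator `f ∂/∂θ + g θ ∂/∂t` of `𝒟`. In
these terms `f` is a unit, `g` is a nonzerodivisor which has simple zeros at the punctures, and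
a superconformal vector field with even part `(α, β)` and odd part `(γ, η)` satisfies two
equations. -/
structure IsSplitFrame {U : S.X.even.Opens} (ch : Chart S.X U) (f g : Γ(S.X.even, U)) : Prop where
  isUnit : IsUnit f
  eq_zero_of_mul (b : Γ(S.X.even, U)) : g * b = 0 → b = 0
  evalAt_eq_zero (i : Fin n) (hi : S.puncture i ∈ U) :
    evalAt S.X.toSpec (S.isClosed_puncture i) hi g = 0
  evalAt_deriv_ne_zero (i : Fin n) (hi : S.puncture i ∈ U) :
    evalAt S.X.toSpec (S.isClosed_puncture i) hi (ch.deriv.app U le_rfl g) ≠ 0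
  exists_coeffs (Y : VectorField S.X ⊤) (hY : S.IsSuperconformal Y) : ∃ α β γ η : Γ(S.X.even, U),
    (∀ a b, evenPart (Y.app U le_top) (ch.fn a b) =
      ch.fn (α * ch.deriv.app U le_rfl a) (α * ch.deriv.app U le_rfl b + β * b)) ∧
    (∀ a b, oddPart (Y.app U le_top) (ch.fn a b) =
      ch.fn (η * b) (γ * ch.deriv.app U le_rfl a)) ∧
    f * γ + η * g = 0 ∧
    f * (g * ch.deriv.app U le_rfl α - (α * ch.deriv.app U le_rfl g + β * g)) =
      g * (f * β - α * ch.deriv.app U le_rfl f)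

lemma exists_isSplitFrame {V : S.X.even.Opens} {x : S.X.even} (hx : x ∈ V) :
    ∃ U ≤ V, x ∈ U ∧ ∃ (ch : Chart S.X U) (f g : Γ(S.X.even, U)), S.IsSplitFrame ch f g := by
  obtain ⟨V₁, hx₁, E, D₀, p, hE, hD, hfr, hbr⟩ := S.exists_frame x
  obtain ⟨V₂, hx₂, p₂, hp₂⟩ := S.ideal_cartier x
  obtain ⟨V₃, hx₃, ⟨ch₀⟩⟩ := S.isSupercurve.exists_chart x
  let U := V ⊓ (V₁ ⊓ (V₂ ⊓ V₃))
  have h₁ : U ≤ V₁ := inf_le_right.trans inf_le_left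
  have h₂ : U ≤ V₂ := inf_le_right.trans (inf_le_right.trans inf_le_left)
  have h₃ : U ≤ V₃ := inf_le_right.trans (inf_le_right.trans inf_le_right)
  let ch := ch₀.restrict h₃
  let d := ch.deriv.app U le_rfl
  have hd1 : d 1 = 0 := by
    have := ch.deriv.map_constant le_rfl 1
    rwa [map_one] at this
  have hdt : d ch.t = 1 := ch.deriv_t
  have hres {W : S.X.even.Opens} (hW : W ≤ V₁) :
      Fun.res hW (Fun.ofEven p) = Fun.ofEven (rs hW p) := by ext <;> simp [rs]
  -- the frame in coordinates
  obtain ⟨h, κ, _, _, hE₀, _⟩ := ch.exists_coeffs (E.res h₁)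
  obtain ⟨_, _, g, f, _, hD₁⟩ := ch.exists_coeffs (D₀.res h₁)
  have hEapp (a b) : E.app U h₁ (ch.fn a b) = ch.fn (h * d a) (h * d b + κ * b) := by
    rw [← evenPart_add_oddPart, hE U h₁]
    exact (add_zero _).trans (hE₀ a b)
  have hDapp (a b) : D₀.app U h₁ (ch.fn a b) = ch.fn (f * b) (g * d a) := by
    rw [← evenPart_add_oddPart, hD U h₁]
    exact (zero_add _).trans (hD₁ a b)
  have hDodd (z) : oddPart (D₀.app U h₁) z = D₀.app U h₁ z := by
    conv_rhs => rw [← evenPart_add_oddPart, hD U h₁]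
    exact (zero_add _).symm
  -- since it is a frame, `f` and `h` are units
  have hsurj (Z : VectorField S.X U) : ∃ a b : Γ(S.X.even, U), ∀ z w,
      (Z.app U le_rfl (ch.fn z w)).ev = a * (h * d z) + b * (f * w) := by
    obtain ⟨⟨q, r⟩, hqr⟩ := (hfr U h₁).1.2 Z
    obtain ⟨a, a', rfl⟩ := ch.exists_eq_fn q
    obtain ⟨b, b', rfl⟩ := ch.exists_eq_fn r
    refine ⟨a, b, fun z w ↦ ?_⟩
    rw [← hqr]
    change (Fun.res _ (ch.fn a a') * E.app U h₁ _ + Fun.res _ (ch.fn b b') * D₀.app U h₁ _).ev = _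
    rw [hEapp, hDapp]
    have hr (z : Fun S.X U) : Fun.res le_rfl z = z := by ext <;> simp
    simp only [hr, ch.fn_mul_fn, ch.fn_add_fn, ch.ev_fn]
  have hf : IsUnit f := by
    obtain ⟨a, b, hab⟩ := hsurj ch.dθ
    have h1 := hab 0 1
    have h2 : (ch.dθ.app U le_rfl (ch.fn 0 1)).ev = 1 := by
      change ch.coeff U le_rfl (ch.fn 0 1).od = 1
      rw [ch.od_fn, one_smul, ← ch.coeff_θ le_rfl, ro_refl]
    rw [h2, map_zero, mul_zero, mul_zero, zero_add, mul_one] at h1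
    exact .of_mul_eq_one_right b h1.symm
  have hh : IsUnit h := by
    obtain ⟨a, b, hab⟩ := hsurj ch.dt
    have h1 := hab ch.t 0
    have h2 : (ch.dt.app U le_rfl (ch.fn ch.t 0)).ev = 1 := by
      have : (ch.dt.app U le_rfl (ch.fn ch.t 0)).ev = d (ch.fn ch.t 0).ev + 0 := rfl
      rw [this, ch.ev_fn, hdt, add_zero]
    rw [h2, hdt, mul_zero, mul_zero, add_zero, mul_one] at h1
    exact .of_mul_eq_one_right a h1.symm
  -- the bracket of the generator with itself
  have hgf : 2 * (f * g) = rs h₁ p * h := by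
    rw [(hfr V₁ le_rfl).2.1, Submodule.mem_span_singleton] at hbr
    obtain ⟨q, hq⟩ := hbr
    have h1 := congr(($(eq_add_of_sub_eq hq.symm)).app U h₁ (ch.fn ch.t 0))
    obtain ⟨a, b, hab⟩ := ch.exists_eq_fn (Fun.res h₁ q)
    have h2 : (q • D₀.res le_rfl + Fun.ofEven p • E).app U h₁ (ch.fn ch.t 0) =
      Fun.res h₁ q * D₀.app U h₁ (ch.fn ch.t 0) +
        Fun.res h₁ (Fun.ofEven p) * E.app U h₁ (ch.fn ch.t 0) := rfl
    have h3 : (D₀.bracket D₀).app U h₁ (ch.fn ch.t 0) =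
      bracketMap (D₀.app U h₁) (D₀.app U h₁) (ch.fn ch.t 0) := rfl
    have h4 := congr(Fun.ev $(h3.symm.trans (h1.trans h2)))
    simp only [bracketMap, AddMonoidHom.add_apply, AddMonoidHom.sub_apply, AddMonoidHom.comp_apply,
      hD U h₁, hDodd, hDapp, hEapp, hab, hres, AddMonoidHom.zero_apply, map_zero, map_add, map_sub,
      ch.fn_mul_fn, ch.ev_fn, hdt, Fun.ev_mul, Fun.ev_ofEven, Fun.od_ofEven,
      LinearMap.zero_apply] at h4
    linear_combination h4
  have hideal {W : S.X.even.Opens} (hW : W ≤ U) {a : Fun S.X W} (ha : a ∈ S.ideal W) :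
      ∃ c, a.ev = c * rs (hW.trans h₁) p := by
    rw [(hfr W (hW.trans h₁)).2.2, Ideal.mem_span_singleton', hres] at ha
    obtain ⟨c, rfl⟩ := ha
    exact ⟨c.ev, by simp⟩
  have hp (i : Fin n) (hi : S.puncture i ∈ U) :
      evalAt S.X.toSpec (S.isClosed_puncture i) hi (rs h₁ p) = 0 := by
    rw [evalAt_eq_zero_iff]
    refine (S.mem_range_puncture_iff _).1 ⟨i, rfl⟩ U hi (Fun.ofEven (rs h₁ p)) ?_
    rw [(hfr U h₁).2.2, hres]
    exact Ideal.subset_span rfl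
  have hg0 (i : Fin n) (hi : S.puncture i ∈ U) :
      evalAt S.X.toSpec (S.isClosed_puncture i) hi g = 0 := by
    have h1 := congr(evalAt S.X.toSpec (S.isClosed_puncture i) hi $hgf)
    rw [_root_.map_mul, _root_.map_mul, _root_.map_mul, hp, zero_mul, map_ofNat] at h1
    have h2 := (hf.map (evalAt S.X.toSpec (S.isClosed_puncture i) hi)).ne_zero
    simpa [h2] using h1
  refine ⟨U, inf_le_left, ⟨hx, hx₁, hx₂, hx₃⟩, ch, f, g, hf, fun b hb ↦ ?_, hg0, fun i hi h0 ↦ ?_,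
    fun Y hY ↦ ?_⟩
  · have h1 : rs h₁ p * b = 0 := by
      refine hh.mul_left_cancel ?_
      linear_combination 2 * f * hb - b * hgf
    obtain ⟨c, hc⟩ := hideal le_rfl (a := Fun.ofEven (rs h₂ p₂)) (by
      have : Fun.ofEven (rs h₂ p₂) = Fun.res h₂ (Fun.ofEven p₂) := by ext <;> simp [rs]
      rw [(hp₂ U h₂).1, this]
      exact Ideal.subset_span rfl)
    have h2 := (hp₂ U h₂).2 (Fun.ofEven b) (by
      ext
      · have : rs h₂ p₂ * b = 0 := by
          rw [Fun.ev_ofEven] at hc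
          rw [hc, mul_assoc, h1, mul_zero]
        simpa [rs] using this
      · simp)
    exact congr(Fun.ev $h2)
  · let φ := evalAt S.X.toSpec (S.isClosed_puncture i) hi
    obtain ⟨W, hW, hiW, a, ha, hFa⟩ := S.exists_eq_ev_of_unramified i hi
      (ch.t - constant S.X.toSpec U (φ ch.t))
      ((evalAt_eq_zero_iff S.X.toSpec (S.isClosed_puncture i) hi _).1 (by simp [φ]))
    obtain ⟨c, hc⟩ := hideal hW ha
    obtain ⟨e, he⟩ := hh.exists_right_inv
    have h1 : rs h₁ p = 2 * f * e * g := by linear_combination -rs h₁ p * he - e * hgf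
    rw [hc, ← rs_rs h₁ hW, h1, _root_.map_mul, ← mul_assoc] at hFa
    have h2 := congr(ch.deriv.app W hW $hFa)
    rw [← ch.deriv.rs_app le_rfl, map_sub, ch.deriv.map_constant, ch.deriv_t, sub_zero, map_one,
      ch.deriv.leibniz, ← ch.deriv.rs_app le_rfl] at h2
    have h3 := congr(evalAt S.X.toSpec (S.isClosed_puncture i) hiW $h2)
    rw [map_one, map_add, _root_.map_mul, _root_.map_mul _ (rs hW g), evalAt_rs, evalAt_rs, h0, hg0,
      mul_zero, zero_mul, add_zero] at h3
    exact one_ne_zero h3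
  -- the bracket of the generator with a superconformal vector field
  · obtain ⟨α, β, γ, η, hY₀, hY₁⟩ := ch.exists_coeffs (Y.res (le_top : U ≤ ⊤))
    have hmem := hY U le_top (D₀.res h₁) (by
      rw [(hfr U h₁).2.1]
      exact Submodule.mem_span_singleton_self _)
    rw [(hfr U h₁).2.1, Submodule.mem_span_singleton] at hmem
    obtain ⟨q, hq⟩ := hmem
    obtain ⟨a, b, rfl⟩ := ch.exists_eq_fn q
    have h1 (z : Fun S.X U) : bracketMap (D₀.app U h₁) ((Y.res (le_top : U ≤ ⊤)).app U le_rfl) z =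
        ch.fn a b * D₀.app U h₁ z := by
      have hr (z : Fun S.X U) : Fun.res le_rfl z = z := by ext <;> simp
      conv_rhs => rw [← hr (ch.fn a b)]
      exact congr(($hq).app U le_rfl z).symm
    have h2 (z : Fun S.X U) : D₀.app U h₁ (evenPart ((Y.res (le_top : U ≤ ⊤)).app U le_rfl) z) +
        D₀.app U h₁ (oddPart ((Y.res (le_top : U ≤ ⊤)).app U le_rfl) z) -
        evenPart ((Y.res (le_top : U ≤ ⊤)).app U le_rfl) (D₀.app U h₁ z) +
        oddPart ((Y.res (le_top : U ≤ ⊤)).app U le_rfl) (D₀.app U h₁ z) =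
        ch.fn a b * D₀.app U h₁ z := by
      rw [← h1, ← map_add, evenPart_add_oddPart]
      simp only [bracketMap, AddMonoidHom.add_apply, AddMonoidHom.sub_apply,
        AddMonoidHom.comp_apply, hD U h₁, hDodd, AddMonoidHom.zero_apply, map_zero, zero_add,
        add_zero]
    have h3 := h2 (ch.fn ch.t 0)
    have h4 := h2 (ch.fn 0 1)
    simp only [hY₀, hY₁, hDapp, ch.fn_mul_fn, ch.fn_add_fn, ch.fn_sub_fn] at h3 h4
    obtain ⟨h5, h6⟩ := ch.fn_injective h3
    obtain ⟨h7, -⟩ := ch.fn_injective h4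
    change _ = _ at h5 h6 h7
    have hd : ch.deriv.app U le_rfl = d := rfl
    simp only [hd, hdt, hd1, map_zero, mul_zero, mul_one, add_zero, zero_add, sub_zero] at h5 h6 h7
    refine ⟨α, β, γ, η, hY₀, hY₁, ?_, ?_⟩
    · linear_combination h5
    · linear_combination f * h6 - g * h7

variable {S}

/-- The derivations of `𝒪⁺` given by the even part of a superconformal vector field and by the
square of its odd part vanish at the punctures. -/
lemma IsSuperconformal.vanishesAt {Y : VectorField S.X ⊤} (hY : S.IsSuperconformal Y) (i : Fin n) :
    Y.evenDer.VanishesAt (S.isClosed_puncture i) ∧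
      (Y.oddSqDer S.isSupercurve.mul_eq_zero).VanishesAt (S.isClosed_puncture i) := by
  have hloc {V : S.X.even.Opens} (hV : S.puncture i ∈ V) (a : Γ(S.X.even, V)) :
      evalAt S.X.toSpec (S.isClosed_puncture i) hV (Y.evenDer.app V le_top a) = 0 ∧
      evalAt S.X.toSpec (S.isClosed_puncture i) hV
        ((Y.oddSqDer S.isSupercurve.mul_eq_zero).app V le_top a) = 0 := by
    obtain ⟨U, hUV, hi, ch, f, g, h⟩ := S.exists_isSplitFrame hV
    obtain ⟨α, β, γ, η, hY₀, hY₁, e₁, e₂⟩ := h.exists_coeffs Y hY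
    obtain ⟨h₁, h₂⟩ := ch.der_eq hY₀ hY₁ S.isSupercurve.mul_eq_zero (rs hUV a)
    rw [← evalAt_rs S.X.toSpec (S.isClosed_puncture i) hUV hi,
      ← evalAt_rs S.X.toSpec (S.isClosed_puncture i) hUV hi, SheafDerivation.rs_app,
      SheafDerivation.rs_app, h₁, h₂]
    let φ := evalAt S.X.toSpec (S.isClosed_puncture i) hi
    have hf : φ f ≠ 0 := (h.isUnit.map φ).ne_zero
    have hg : φ g = 0 := h.evalAt_eq_zero i hi
    have hg' : φ (ch.deriv.app U le_rfl g) ≠ 0 := h.evalAt_deriv_ne_zero i hi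
    have e₃ := congr(φ $e₁)
    have e₄ := congr(φ $e₂)
    simp only [_root_.map_mul, map_add, map_sub, hg, map_zero, zero_mul, mul_zero, add_zero,
      zero_sub] at e₃ e₄
    have hα : φ α = 0 := by simpa [hf, hg'] using e₄
    have hγ : φ γ = 0 := by simpa [hf] using e₃
    constructor
    · change φ _ = 0
      rw [_root_.map_mul, hα, zero_mul]
    · change φ _ = 0
      rw [_root_.map_mul, _root_.map_mul, hγ, zero_mul, mul_zero]
  exact ⟨fun V hV a ↦ (hloc hV a).1, fun V hV a ↦ (hloc hV a).2⟩

/-- A superconformal vector field for which these two derivations are zero is itself zero. -/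
lemma IsSuperconformal.eq_zero {Y : VectorField S.X ⊤} (hY : S.IsSuperconformal Y)
    (h₀ : ∀ (V : S.X.even.Opens) (a : Γ(S.X.even, V)), Y.evenDer.app V le_top a = 0)
    (h₁ : ∀ (V : S.X.even.Opens) (a : Γ(S.X.even, V)),
      (Y.oddSqDer S.isSupercurve.mul_eq_zero).app V le_top a = 0) : Y = 0 := by
  refine VectorField.ext_app fun V hV z ↦ ?_
  have hloc (x : S.X.even) (hx : x ∈ V) : ∃ (U : S.X.even.Opens) (hU : U ≤ V), x ∈ U ∧
      Fun.res hU (Y.app V hV z) = 0 := by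
    obtain ⟨U, hUV, hxU, ch, f, g, h⟩ := S.exists_isSplitFrame hx
    obtain ⟨α, β, γ, η, hY₀, hY₁, e₁, e₂⟩ := h.exists_coeffs Y hY
    obtain ⟨h₂, h₃⟩ := ch.der_eq hY₀ hY₁ S.isSupercurve.mul_eq_zero ch.t
    rw [h₀, ch.deriv_t, mul_one] at h₂
    rw [h₁, ch.deriv_t, mul_one] at h₃
    have hα : α = 0 := h₂.symm
    have hβ : β = 0 := by
      refine h.eq_zero_of_mul _ (h.isUnit.mul_left_cancel (b := g * β) (c := 0) ?_)
      have h2 : IsUnit (2 : Γ(S.X.even, U)) := by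
        have := (IsUnit.mk0 (2 : k) two_ne_zero).map (constant S.X.toSpec U)
        rwa [map_ofNat] at this
      refine h2.mul_left_cancel ?_
      rw [hα, map_zero] at e₂
      linear_combination -e₂
    have hη : η = 0 := by
      have : η * η = 0 := h.eq_zero_of_mul _ (by linear_combination η * e₁ + f * h₃)
      have hred : IsNilpotent η := ⟨2, by rw [pow_two, this]⟩
      exact hred.eq_zero
    have hγ : γ = 0 := by
      refine h.isUnit.mul_left_cancel ?_
      rw [hη] at e₁
      linear_combination e₁
    refine ⟨U, hUV, hxU, ?_⟩
    obtain ⟨a, b, hab⟩ := ch.exists_eq_fn (Fun.res hUV z)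
    rw [Y.res_app, hab, ← evenPart_add_oddPart, hY₀, hY₁, hα, hβ, hγ, hη]
    simp [ch.fn_zero]
  ext
  · refine eq_of_locally_eq fun x hx ↦ ?_
    obtain ⟨U, hU, hxU, h⟩ := hloc x hx
    exact ⟨U, hU, hxU, (Fun.ev_res_eq hU _).symm.trans
      (congr(Fun.ev $h).trans (map_zero (rs hU)).symm)⟩
  · refine odd_eq_of_locally_eq fun x hx ↦ ?_
    obtain ⟨U, hU, hxU, h⟩ := hloc x hx
    exact ⟨U, hU, hxU, (Fun.od_res_eq hU _).symm.trans
      (congr(Fun.od $h).trans (map_zero (ro hU)).symm)⟩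

end SuperRiemannSurface
end SuperGeometry

end

theorem mainTheorem9 {k : Type u} [Field k] [IsAlgClosed k] [CharZero k] (n : ℕ) (hn : 4 ≤ n)
    (S : SuperGeometry.SuperRiemannSurface k n) (hS : S.IsGenusZero)
    (Y : SuperGeometry.SuperScheme.VectorField S.X ⊤) (hY : S.IsSuperconformal Y) :
    Y = 0 := by
  have hne {i j : ℕ} (hi : i < n) (hj : j < n) (hij : i ≠ j) :
      S.puncture ⟨i, hi⟩ ≠ S.puncture ⟨j, hj⟩ :=
    S.puncture_injective.ne fun h ↦ hij (congr_arg Fin.val h)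
  have hzero (v : SuperGeometry.SheafDerivation S.X.toSpec ⊤)
      (hv : ∀ i, v.VanishesAt (S.isClosed_puncture i)) (V : S.X.even.Opens) (a : Γ(S.X.even, V)) :
      v.app V le_top a = 0 :=
    v.app_eq_zero_of_vanishesAt S.isSupercurve.exists_isCoord (S.isSupercurve.splitsOnPairs hS)
      (S.isClosed_puncture ⟨0, by omega⟩) (S.isClosed_puncture ⟨1, by omega⟩)
      (S.isClosed_puncture ⟨2, by omega⟩) (hne _ _ (by omega)) (hne _ _ (by omega))
      (hne _ _ (by omega)) (hv _) (hv _) (hv _) a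
  exact hY.eq_zero (hzero _ fun i ↦ (hY.vanishesAt i).1) (hzero _ fun i ↦ (hY.vanishesAt i).2)
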